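/- A concurrent game structure (CGS) under imperfect information consists of finite non-empty sets $Ag=\{1,\dots,k\}$ (agents), $S$ (states), $\Pi$ (atomic propositions), $Act$ (actions), a labelling $\pi:S\to\mathcal P(\Pi)$, an equivalence relation $\sim_i$ on $S$ for each agent $i$, a map $d:Ag\times S\to\mathcal P(Act)\setminus\{\emptyset\}$ with $d(i,s)=d(i,s')$ whenever $s\sim_i s'$, and a partial transition function from $S\times Act^k$ to $S$ that is defined at $(s,(a_1,\dots,a_k))$ if and only if $a_i\in d(i,s)$ for all $i$. A perfect recall strategy of agent $i$ is a function $\sigma:S^+\to Act$ with $\sigma(\alpha s)\in d(i,s)$ for all $\alpha\in S^*$, $s\in S$, and $\sigma(\alpha)=\sigma(\alpha')$ whenever $\alpha,\alpha'$ have the same length and are componentwise $\sim_i$-equivalent; a strategy $\sigma_A$ of a team $A\subseteq Ag$ is a family $(\sigma_i)_{i\in A}$ of such strategies. Let $out(s,\sigma_A)$ be the set of infinite sequences $s_0s_1s_2\cdots$ with $s_0=s$ such that for each $j\ge 0$ some action tuple $a$ with $a_i=\sigma_i(s_0\cdots s_j)$ for $i\in A$ and $a_i\in d(i,s_j)$ for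 $i\notin A$ leads from $s_j$ to $s_{j+1}$. The formulas of ATL are built from atomic propositions by $\neg$, $\wedge$, $\langle\langle A\rangle\rangle\bigcirc\varphi$, $\langle\langle A\rangle\rangle\Box\varphi$ and $\langle\langle A\rangle\rangle\varphi U\psi$ with $\emptyset\ne A\subseteq Ag$. The relation $(\mathcal G,s)\models_{iR}\varphi$ is defined as usual for atoms and Boolean connectives, and $(\mathcal G,s)\models_{iR}\langle\langle A\rangle\rangle\theta$ holds if there is a perfect recall strategy $\sigma_A$ such that every sequence in $out(s,\sigma_A)$ satisfies $\theta$, where $\bigcirc$, $\Box$, $U$ mean next, globally and until. A deterministic Turing machine $M=(Q,\Sigma,q_0,B,\delta)$ has finite sets $Q$ of states and $\Sigma$ of tape symbols, an initial state $q_0$, a blank symbol $B\in\Sigma$, a partial transition function $\delta$ from $Q\times\Sigma$ to $Q\times\Sigma\times\{L,R\}$, and a tape that is infinite to the right only. It halts on the empty word if, started in $q_0$ on the leftmost cell of the blank tape, it reaches a configuration in which $\delta$ is undefined or requires a left move from the leftmost cell. Theorem. (1) The model checking problem for ATL under the imperfect information, perfect recall semantics $\models_{iR}$ is undecidable: there is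 no algorithm that, given (finite descriptions of) a CGS $\mathcal G$ under imperfect information, a state $s$ of $\mathcal G$ and an ATL formula $\varphi$, decides whether $(\mathcal G,s)\models_{iR}\varphi$. (2) Moreover, there is an algorithm that transforms (the finite description of) every deterministic Turing machine $M$ into (the finite description of) a CGS $\mathcal G$ under imperfect information with agents $\{1,2,3\}$, a state $s_{init}$ of $\mathcal G$ and a formula $\langle\langle\{1,2\}\rangle\rangle\Box\,ok$ with an atomic proposition $ok$, such that $M$ does not halt on the empty word if and only if $(\mathcal G,s_{init})\models_{iR}\langle\langle\{1,2\}\rangle\rangle\Box\,ok$. -/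

import Mathlib

namespace ATLiR

/-- Syntax of `ATL` over a set `Ag` of agents and a set `P` of atomic propositions:
atoms, negation, conjunction, `⟨⟨A⟩⟩ ◯ φ`, `⟨⟨A⟩⟩ □ φ` and `⟨⟨A⟩⟩ φ U ψ`, for non-empty `A`. -/
inductive Formula (Ag P : Type) : Type
  | atom (p : P) : Formula Ag P
  | neg (φ : Formula Ag P) : Formula Ag P
  | conj (φ ψ : Formula Ag P) : Formula Ag P
  | next (A : Finset Ag) (hA : A.Nonempty) (φ : Formula Ag P) : Formula Ag P
  | globally (A : Finset Ag) (hA : A.Nonempty) (φ : Formula Ag P) : Formula Ag P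
  | untl (A : Finset Ag) (hA : A.Nonempty) (φ ψ : Formula Ag P) : Formula Ag P

/-- A concurrent game structure under imperfect information with agents `Ag`, states `S`,
atomic propositions `P` and actions `Act`. -/
structure CGS (Ag S P Act : Type) where
  /-- the state-labelling function `π` -/
  label : S → Set P
  /-- the observation equivalences `∼ᵢ` -/
  obs : Ag → Setoid S
  /-- the actions available to an agent at a state -/
  avail : Ag → S → Set Act
  avail_nonempty : ∀ i s, (avail i s).Nonempty
  avail_obs : ∀ i s s', obs i s s' → avail i s = avail i s'
  /-- the partial transition function on action tuples -/
  trans : S → (Ag → Act) → Option S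
  trans_isSome : ∀ s a, (trans s a).isSome ↔ ∀ i, a i ∈ avail i s

namespace CGS

variable {Ag S P Act : Type}

/-- A perfect recall strategy of agent `i`. A non-empty sequence of states is given as
a pair `α`, `s`: it is the sequence `α` followed by the last state `s`. -/
structure Strategy (G : CGS Ag S P Act) (i : Ag) where
  act : List S → S → Act
  act_avail : ∀ α s, act α s ∈ G.avail i s
  act_obs : ∀ α α' s s', List.Forall₂ (fun t t' => G.obs i t t') α α' → G.obs i s s' →
    act α s = act α' s'

/-- A perfect recall strategy for a team `A` of agents. -/
abbrev TeamStrategy (G : CGS Ag S P Act) (A : Finset Ag) : Type :=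
  (i : {i : Ag // i ∈ A}) → G.Strategy i.1

/-- The action tuple `a` is allowed by the team strategy `σ` after the history `α s`. -/
def Allowed (G : CGS Ag S P Act) {A : Finset Ag} (σ : G.TeamStrategy A)
    (α : List S) (s : S) (a : Ag → Act) : Prop :=
  (∀ i, i ∉ A → a i ∈ G.avail i s) ∧ ∀ i : {i : Ag // i ∈ A}, a i.1 = (σ i).act α s

/-- The infinite sequences of states that start in `s` and are consistent with `σ`. -/
def out (G : CGS Ag S P Act) {A : Finset Ag} (s : S) (σ : G.TeamStrategy A) : Set (ℕ → S) :=
  {l | l 0 = s ∧ ∀ j, ∃ a, G.Allowed σ ((List.range j).map l) (l j) a ∧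
    G.trans (l j) a = some (l (j + 1))}

/-- The imperfect information, perfect recall semantics `(G, s) ⊨ φ` (de dicto: the outcomes
are those that start in the actual state `s`). -/
def Sat (G : CGS Ag S P Act) : S → Formula Ag P → Prop
  | s, .atom p => p ∈ G.label s
  | s, .neg φ => ¬ G.Sat s φ
  | s, .conj φ ψ => G.Sat s φ ∧ G.Sat s ψ
  | s, .next A _ φ => ∃ σ : G.TeamStrategy A, ∀ l ∈ G.out s σ, G.Sat (l 1) φ
  | s, .globally A _ φ => ∃ σ : G.TeamStrategy A, ∀ l ∈ G.out s σ, ∀ j, G.Sat (l j) φ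
  | s, .untl A _ φ ψ => ∃ σ : G.TeamStrategy A, ∀ l ∈ G.out s σ,
      ∃ j, G.Sat (l j) ψ ∧ ∀ k < j, G.Sat (l k) φ

end CGS

/-- An input of the model checking problem: a finite game structure, a state and a formula.
The finite non-empty sets of agents, states, propositions and actions are initial segments
of the natural numbers. -/
structure Instance where
  numAgents : ℕ
  numStates : ℕ
  numProps : ℕ
  numActs : ℕ
  agents_pos : 0 < numAgents
  states_pos : 0 < numStates
  props_pos : 0 < numProps
  acts_pos : 0 < numActs
  G : CGS (Fin numAgents) (Fin numStates) (Fin numProps) (Fin numActs)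
  state : Fin numStates
  formula : Formula (Fin numAgents) (Fin numProps)

/-- The question asked about an input. -/
def Instance.Holds (I : Instance) : Prop := I.G.Sat I.state I.formula

/-- Prefix notation for formulas. A coalition is written as its characteristic 0-1 word,
which has one letter for each of the `k` agents. -/
def Formula.code {k p : ℕ} : Formula (Fin k) (Fin p) → List ℕ
  | .atom q => [0, (q : ℕ)]
  | .neg φ => 1 :: φ.code
  | .conj φ ψ => 2 :: (φ.code ++ ψ.code)
  | .next A _ φ => 3 :: (List.ofFn (fun i => if i ∈ A then 1 else 0) ++ φ.code)
  | .globally A _ φ => 4 :: (List.ofFn (fun i => if i ∈ A then 1 else 0) ++ φ.code)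
  | .untl A _ φ ψ =>
      5 :: (List.ofFn (fun i => if i ∈ A then 1 else 0) ++ (φ.code ++ ψ.code))

/-- Finite descriptions of inputs: the numbers of agents, states, propositions and actions;
the tables of the labelling, of the observation equivalences, of the available actions and
of the transition function; the state; the formula. -/
abbrev InstanceCode : Type :=
  (ℕ × ℕ × ℕ × ℕ) × List (List Bool) × List (List (List Bool)) × List (List (List Bool)) ×
    List (List (Option ℕ)) × ℕ × List ℕ

open Classical in
/-- The description of an input. Every table is complete. In the row of a state, the table of
the transition function lists the action tuples `a` in the order of the numbers
`∑ i, a i * (numActs) ^ i`. -/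
noncomputable def Instance.code (I : Instance) : InstanceCode :=
  ((I.numAgents, I.numStates, I.numProps, I.numActs),
    List.ofFn (fun s => List.ofFn fun p => decide (p ∈ I.G.label s)),
    List.ofFn (fun i => List.ofFn fun s => List.ofFn fun s' => decide (I.G.obs i s s')),
    List.ofFn (fun i => List.ofFn fun s => List.ofFn fun a => decide (a ∈ I.G.avail i s)),
    List.ofFn (fun s => List.ofFn fun c : Fin (I.numActs ^ I.numAgents) =>
      (I.G.trans s (finFunctionFinEquiv.symm c)).map Fin.val),
    (I.state : ℕ), I.formula.code)

/-- Decidability of the model checking problem: some algorithm gives the correct answer on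
the description of every input. -/
def ModelCheckingDecidable : Prop :=
  ∃ f : InstanceCode → Bool, Computable f ∧ ∀ I : Instance, f I.code = true ↔ I.Holds

/-- Deterministic Turing machines with states `Q`, tape alphabet `A` and a tape that is
infinite to the right only. -/
structure TM (Q A : Type) where
  start : Q
  blank : A
  δ : Q → A → Option (Q × A × Turing.Dir)

namespace TM

variable {Q A : Type}

/-- Configurations: state, head position and tape content; the leftmost cell has number `0`. -/
structure Cfg (Q A : Type) where
  state : Q
  head : ℕ
  tape : ℕ → A

/-- The initial configuration on the empty word. -/
def init (M : TM Q A) : Cfg Q A := ⟨M.start, 0, fun _ => M.blank⟩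

/-- One step. There is no next configuration if `δ` is undefined or if the head would move
to the left of the leftmost cell. -/
def step (M : TM Q A) (c : Cfg Q A) : Option (Cfg Q A) :=
  match M.δ c.state (c.tape c.head), c.head with
  | none, _ => none
  | some (q, b, .right), h => some ⟨q, h + 1, Function.update c.tape h b⟩
  | some (_, _, .left), 0 => none
  | some (q, b, .left), h + 1 => some ⟨q, h, Function.update c.tape (h + 1) b⟩

/-- `M` halts on the empty word. -/
def Halts (M : TM Q A) : Prop :=
  ∃ c, Relation.ReflTransGen (fun c c' => M.step c = some c') M.init c ∧ M.step c = none

/-- Finite descriptions of machines: the numbers of states and of symbols, the initial state,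
the blank symbol and the table of `δ` (`true` stands for a move to the right). -/
abbrev Code : Type := (ℕ × ℕ) × ℕ × ℕ × List (List (Option (ℕ × ℕ × Bool)))

/-- The description of a machine. -/
def code {n m : ℕ} (M : TM (Fin n) (Fin m)) : Code :=
  ((n, m), (M.start : ℕ), (M.blank : ℕ),
    List.ofFn (fun q => List.ofFn fun a => (M.δ q a).map fun t =>
      ((t.1 : ℕ), (t.2.1 : ℕ), match t.2.2 with
        | .left => false
        | .right => true)))

end TM

end ATLiR

/-!
The infinite runs of a Turing machine `M` on the empty word are the tilings of the positions
`(x, n)` with `x ≤ n` by tiles that describe cell `x` at time `n`, subject to conditions on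
vertical and horizontal neighbours. Two agents who claim to know a tiling can be examined as
follows: each of them is told its column only by the number of rounds for which it had to wait, and
then it has to list the tiles of this column from the bottom upwards, one in each round. If both
agents are told in the same round, they must give the same answers, and these must satisfy the
vertical conditions; if one of them is told one round later, they list neighbouring columns, always
in the same row, and the answers must satisfy the horizontal conditions. Since no agent observes
when the other one is told, the agents can avoid being caught forever if and only if a tiling
exists.

Undecidability follows because the halting problem for partial recursive functions reduces to that
for these machines on the empty word. A two-sided tape is simulated on a one-sided one by folding
it, and the input is written by additional states.
-/

namespace ATLiR

/-- Tiles for the positions `(x, n)` with `x ≤ n`, where `x` is the column and `n` the row: which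
tiles may be put at `(0, 0)`, which ones at the bottom `(x, x)` of the other columns, which ones
(second argument) directly above a given tile and which ones directly to its right. -/
structure TileSet (T : Type*) where
  corner : T → Prop
  bottom : T → Prop
  above : T → T → Prop
  beside : T → T → Prop

namespace TileSet

variable {T : Type*}

/-- `f x n` is the tile at `(x, n)`; its values for `n < x` are irrelevant. -/
structure IsTiling (𝒯 : TileSet T) (f : ℕ → ℕ → T) : Prop where
  corner : 𝒯.corner (f 0 0)
  bottom x : 𝒯.bottom (f (x + 1) (x + 1))
  above {x n} : x ≤ n → 𝒯.above (f x n) (f x (n + 1))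
  beside {x n} : x < n → 𝒯.beside (f x n) (f (x + 1) n)

/-- Every position can be given a tile so that all conditions hold. -/
def Tileable (𝒯 : TileSet T) : Prop := ∃ f, 𝒯.IsTiling f

/-- The tiles `0, …, W - 1` with the vertical conditions `V` and the horizontal conditions `H`.
The floor below column `0` counts as a tile `0`, the floor below the other columns as a
tile `1`. -/
def numbered (W : ℕ) (V H : ℕ → ℕ → Bool) : TileSet (Fin W) where
  corner t := V 0 t
  bottom t := V 1 t
  above t u := V t u
  beside t u := H t u

end TileSet

namespace TilingGame

/-! ### The tiling game -/

/-- Neither agent has been told its column, which lies above the floor `v`. -/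
def waiting (v : ℕ) : ℕ := 5 * v

/-- Both agents fill the same column, and `v` is its last tile or its floor. -/
def same (v : ℕ) : ℕ := 5 * v + 1

/-- Agent `0` has been told its column and agent `1` is about to be told the next one. -/
def split : ℕ := 2

/-- The agents fill neighbouring columns. -/
def adjacent : ℕ := 3

/-- The agents have been caught. -/
def lost : ℕ := 4

/-- The state after `s` if the agents `0` and `1` put the tiles `a` and `b` and the environment
plays `e`. A state is read modulo `5`; the quotient is the argument of `waiting` and `same`. -/
def next (V H : ℕ → ℕ → Bool) (s a b e : ℕ) : ℕ :=
  if s % 5 = 0 then if e = 0 then waiting 1 else if e = 1 then same (s / 5) else split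
  else if s % 5 = 1 then if a = b ∧ V (s / 5) a = true then same a else lost
  else if s % 5 = 2 then adjacent
  else if s % 5 = 3 then if H a b = true then adjacent else lost
  else lost

/-- What agent `i` observes: whether it has not been told its column yet. -/
def waits (i s : ℕ) : Bool := decide (s % 5 = 0 ∨ i = 1 ∧ s % 5 = 2)

section

variable (V H : ℕ → ℕ → Bool) (v a b e i : ℕ)

theorem next_waiting : next V H (waiting v) a b e =
    if e = 0 then waiting 1 else if e = 1 then same v else split := by
  simp [next, waiting]

theorem next_same : next V H (same v) a b e =
    if a = b ∧ V v a = true then same a else lost := by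
  have hv : (5 * v + 1) / 5 = v := by omega
  simp [next, same, hv]

theorem next_split : next V H split a b e = adjacent := rfl

theorem next_adjacent : next V H adjacent a b e = if H a b = true then adjacent else lost := rfl

theorem next_lt {W : ℕ} (hW : 3 ≤ W) (V H : ℕ → ℕ → Bool) {s a : ℕ} (b e : ℕ)
    (hs : s < 5 * W) (ha : a < W) : next V H s a b e < 5 * W := by
  unfold next waiting same split adjacent lost
  split_ifs <;> omega

theorem waits_waiting : waits i (waiting v) = true := by simp [waits, waiting]

theorem waits_same : waits i (same v) = false := by simp [waits, same]

theorem waits_split : waits i split = decide (i = 1) := by simp [waits, split]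

theorem waits_adjacent : waits i adjacent = false := by simp [waits, adjacent]

theorem waits_lost : waits i lost = false := by simp [waits, lost]

theorem same_ne_lost : same v ≠ lost := by unfold same lost; omega

theorem waiting_ne_lost : waiting v ≠ lost := by unfold waiting lost; omega

end

/-- The game in which the agents `0` and `1` claim to know a tiling. The environment, agent `2`,
lets them wait for as many rounds as there are columns to the left of the one it is going to
ask for. In each round after that an agent puts the next tile of its column, and all it has seen
is how long it had to wait. Since the environment asks for the same column or for neighbouring
columns, contradictory or wrong answers are caught. -/
def game (W : ℕ) (hW : 3 ≤ W) (V H : ℕ → ℕ → Bool) :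
    CGS (Fin 3) (Fin (5 * W)) (Fin 1) (Fin W) where
  label s := {_p | s.val ≠ lost}
  obs i := Setoid.ker fun s => waits i s
  avail _ _ := Set.univ
  avail_nonempty _ _ := ⟨⟨0, by omega⟩, trivial⟩
  avail_obs _ _ _ _ := rfl
  trans s a := some ⟨next V H s (a 0) (a 1) (a 2), next_lt hW V H _ _ s.2 (a 0).2⟩
  trans_isSome _ _ := by simp

/-- The state in which the game starts. -/
def initial {W : ℕ} (hW : 3 ≤ W) : Fin (5 * W) := ⟨waiting 0, by unfold waiting; omega⟩

variable {W : ℕ} {hW : 3 ≤ W} {V H : ℕ → ℕ → Bool}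

/-- The agents `0` and `1` have a strategy to avoid the state `lost` forever. -/
abbrev Winnable (W : ℕ) (hW : 3 ≤ W) (V H : ℕ → ℕ → Bool) : Prop :=
  (game W hW V H).Sat (initial hW) (.globally {0, 1} (by simp) (.atom 0))

/-! ### A tiling yields a strategy -/

theorem obs_iff {i : Fin 3} {s t : Fin (5 * W)} :
    (game W hW V H).obs i s t ↔ waits i s = waits i t := Iff.rfl

/-- The number of states of the history `α` in which agent `i` has to wait. -/
def numWaits {N : ℕ} (i : ℕ) (α : List (Fin N)) : ℕ := α.countP fun s : Fin N => waits i s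

theorem numWaits_append_singleton {N : ℕ} (i : ℕ) (α : List (Fin N)) (s : Fin N) :
    numWaits i (α ++ [s]) = numWaits i α + (waits i s).toNat := by
  cases h : waits i s <;> simp [numWaits, h]

theorem numWaits_congr {i : Fin 3} {α α' : List (Fin (5 * W))}
    (h : List.Forall₂ (fun t t' => (game W hW V H).obs i t t') α α') :
    numWaits i α = numWaits i α' := by
  induction h with
  | nil => rfl
  | cons h _ ih =>
    unfold numWaits at ih ⊢
    rw [List.countP_cons, List.countP_cons, ih, obs_iff.1 h]

/-- The strategy of agent `i` that describes the tiling `f`: after waiting in `x + 1` states it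
fills column `x`, and at time `n + 1` it puts a tile of row `n`. -/
def tilingStrategy (f : ℕ → ℕ → Fin W) (i : Fin 3) : (game W hW V H).Strategy i where
  act α s := f (numWaits i (α ++ [s]) - 1) (α.length - 1)
  act_avail _ _ := trivial
  act_obs α α' s s' h hs := by
    rw [numWaits_append_singleton, numWaits_append_singleton, numWaits_congr h, obs_iff.1 hs,
      h.length_eq]

/-- `Reached f j s c₀ c₁`: the state `s` can be reached at time `j` against the strategies that
describe `f`, and then the agents `0` and `1` have waited in `c₀` and `c₁` states. -/
inductive Reached (f : ℕ → ℕ → Fin W) : ℕ → ℕ → ℕ → ℕ → Prop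
  | waiting (j : ℕ) : Reached f j (waiting (min j 1)) (j + 1) (j + 1)
  | floor (x : ℕ) : Reached f (x + 1) (same (min x 1)) (x + 1) (x + 1)
  | same {x n : ℕ} : x ≤ n → Reached f (n + 2) (same (f x n)) (x + 1) (x + 1)
  | split (x : ℕ) : Reached f (x + 1) split (x + 1) (x + 2)
  | adjacent {x n : ℕ} : x < n → Reached f (n + 1) adjacent (x + 1) (x + 2)

theorem floor_le {f : ℕ → ℕ → Fin W} (hf : (TileSet.numbered W V H).IsTiling f) (x : ℕ) :
    V (min x 1) (f x x) = true := by
  cases x with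
  | zero => exact hf.corner
  | succ x => rw [min_eq_right x.succ_pos]; exact hf.bottom x

theorem Reached.succ {f : ℕ → ℕ → Fin W} (hf : (TileSet.numbered W V H).IsTiling f)
    {j s c₀ c₁ t : ℕ} (e : ℕ) (h : Reached f j s c₀ c₁)
    (ht : t = next V H s (f (c₀ - 1) (j - 1)) (f (c₁ - 1) (j - 1)) e) :
    Reached f (j + 1) t (c₀ + (waits 0 t).toNat) (c₁ + (waits 1 t).toNat) := by
  subst ht
  cases h with
  | waiting =>
    rw [next_waiting]
    split_ifs
    · simpa [waits_waiting] using Reached.waiting (f := f) (j + 1)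
    · simpa [waits_same] using Reached.floor (f := f) j
    · simpa [waits_split] using Reached.split (f := f) j
  | floor x =>
    rw [next_same, if_pos ⟨rfl, floor_le hf x⟩, waits_same, waits_same]
    exact .same le_rfl
  | @same x n h =>
    rw [next_same, if_pos ⟨rfl, hf.above h⟩, waits_same, waits_same]
    exact .same (h.trans n.le_succ)
  | split x =>
    rw [next_split, waits_adjacent, waits_adjacent]
    exact .adjacent x.lt_succ_self
  | @adjacent x n h =>
    have hnext : next V H TilingGame.adjacent (f (x + 1 - 1) (n + 1 - 1))
        (f (x + 2 - 1) (n + 1 - 1)) e = TilingGame.adjacent := if_pos (hf.beside h)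
    rw [hnext, waits_adjacent, waits_adjacent]
    exact .adjacent (h.trans n.lt_succ_self)

theorem Reached.ne_lost {f : ℕ → ℕ → Fin W} {j s c₀ c₁ : ℕ} (h : Reached f j s c₀ c₁) :
    s ≠ lost := by
  cases h with
  | waiting => exact waiting_ne_lost _
  | floor => exact same_ne_lost _
  | same => exact same_ne_lost _
  | split => decide
  | adjacent => decide

theorem reached_of_mem_out {f : ℕ → ℕ → Fin W} (hf : (TileSet.numbered W V H).IsTiling f)
    {l : ℕ → Fin (5 * W)}
    (hl : l ∈ (game W hW V H).out (initial hW) fun i : {i // i ∈ ({0, 1} : Finset (Fin 3))} =>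
      tilingStrategy f i.1) (j : ℕ) :
    Reached f j (l j) (numWaits 0 ((List.range j).map l ++ [l j]))
      (numWaits 1 ((List.range j).map l ++ [l j])) := by
  obtain ⟨h0, hl⟩ := hl
  induction j with
  | zero => simpa [h0, initial, waits_waiting, numWaits] using Reached.waiting (f := f) 0
  | succ j ih =>
    obtain ⟨a, ⟨-, ha⟩, ht⟩ := hl j
    have ha0 : a 0 = _ := ha ⟨0, by simp⟩
    have ha1 : a 1 = _ := ha ⟨1, by simp⟩
    rw [numWaits_append_singleton, numWaits_append_singleton, List.range_succ, List.map_append]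
    refine ih.succ hf (a 2) ?_
    simp [← Option.some.inj ht, ha0, ha1, tilingStrategy]

theorem winnable_of_tileable (h : (TileSet.numbered W V H).Tileable) : Winnable W hW V H :=
  let ⟨f, hf⟩ := h
  ⟨fun i => tilingStrategy f i.1, fun _ hl j => (reached_of_mem_out hf hl j).ne_lost⟩

/-! ### A strategy yields a tiling -/

theorem exists_seq_of_history {S : Type*} (s : S) (F : ℕ → List S → S → S) :
    ∃ l : ℕ → S, l 0 = s ∧ ∀ j, l (j + 1) = F j ((List.range j).map l) (l j) := by
  let h : ℕ → List S × S := Nat.rec ([], s) fun j p => (p.1 ++ [p.2], F j p.1 p.2)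
  have fst_eq (j : ℕ) : (h j).1 = (List.range j).map fun j => (h j).2 := by
    induction j with
    | zero => rfl
    | succ j ih => rw [List.range_succ, List.map_append, ← ih]; rfl
  exact ⟨fun j => (h j).2, rfl, fun j => by rw [← fst_eq]⟩

/-- The tile that the strategy `σ` puts in round `k` after it has waited in `x + 1` states.
The states `waiting 0` and `lost` represent what the agent observes. -/
def column {i : Fin 3} (σ : (game W hW V H).Strategy i) (x k : ℕ) : Fin W :=
  let told : Fin (5 * W) := ⟨lost, by unfold lost; omega⟩
  σ.act (List.replicate (x + 1) (initial hW) ++ List.replicate k told) told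

theorem act_eq_column {i : Fin 3} (σ : (game W hW V H).Strategy i) {l : ℕ → Fin (5 * W)}
    {x k : ℕ} (h : ∀ j ≤ x + 1 + k, waits i (l j) = decide (j ≤ x)) :
    σ.act ((List.range (x + 1 + k)).map l) (l (x + 1 + k)) = column σ x k := by
  refine σ.act_obs _ _ _ _ ?_ (obs_iff.2 ?_)
  · refine List.forall₂_iff_get.2 ⟨by simp, fun j hj _ => obs_iff.2 ?_⟩
    simp only [List.length_map, List.length_range] at hj
    simp only [List.get_eq_getElem, List.getElem_map, List.getElem_range, List.getElem_append,
      List.length_replicate, List.getElem_replicate, h j hj.le]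
    split_ifs with hjx
    · simp [initial, waits_waiting, Nat.lt_succ_iff.1 hjx]
    · simpa [waits_lost] using hjx
  · simp only [h _ le_rfl, waits_lost, decide_eq_false_iff_not]
    omega

/-- Agent `0`'s part of the team strategy `σ`. -/
abbrev strategy₀ (σ : (game W hW V H).TeamStrategy {0, 1}) : (game W hW V H).Strategy 0 :=
  σ ⟨0, by simp⟩

/-- Agent `1`'s part of the team strategy `σ`. -/
abbrev strategy₁ (σ : (game W hW V H).TeamStrategy {0, 1}) : (game W hW V H).Strategy 1 :=
  σ ⟨1, by simp⟩

variable {σ : (game W hW V H).TeamStrategy {0, 1}} {e : ℕ → ℕ} {l : ℕ → Fin (5 * W)}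
  {x : ℕ}

/-- `l` is the sequence of states if the environment plays `e` against `σ`. -/
structure IsPlay (σ : (game W hW V H).TeamStrategy {0, 1}) (e : ℕ → ℕ) (l : ℕ → Fin (5 * W)) :
    Prop where
  zero : l 0 = initial hW
  succ j : (l (j + 1)).val = next V H (l j)
    ((strategy₀ σ).act ((List.range j).map l) (l j))
    ((strategy₁ σ).act ((List.range j).map l) (l j)) (e j)

theorem exists_isPlay (σ : (game W hW V H).TeamStrategy {0, 1}) (e : ℕ → ℕ) :
    ∃ l, IsPlay σ e l := by
  obtain ⟨l, zero, succ⟩ := exists_seq_of_history (initial hW) fun j α s =>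
    (⟨next V H s ((strategy₀ σ).act α s) ((strategy₁ σ).act α s) (e j),
      next_lt hW V H _ _ s.2 (Fin.is_lt _)⟩ : Fin (5 * W))
  exact ⟨l, zero, fun j => by rw [succ]⟩

namespace IsPlay

theorem mem_out (hl : IsPlay σ e l) (he : ∀ j, e j < W) :
    l ∈ (game W hW V H).out (initial hW) σ := by
  refine ⟨hl.zero, fun j => ⟨![(strategy₀ σ).act ((List.range j).map l) (l j),
    (strategy₁ σ).act ((List.range j).map l) (l j), ⟨e j, he j⟩],
    ⟨fun _ _ => trivial, ?_⟩, congrArg some (Fin.ext (hl.succ j).symm)⟩⟩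
  rintro ⟨i, hi⟩
  have hi' : i = 0 ∨ i = 1 := by simpa using hi
  rcases hi' with rfl | rfl <;> rfl

theorem eq_waiting (hl : IsPlay σ e l) (he : ∀ j < x, e j = 0) :
    ∀ j ≤ x, (l j).val = waiting (min j 1)
  | 0, _ => by rw [hl.zero]; rfl
  | j + 1, hj => by
    rw [hl.succ, hl.eq_waiting he j (j.le_succ.trans hj), next_waiting, if_pos (he j hj),
      min_eq_right j.succ_pos]

theorem waits_eq_of_told (hl : IsPlay σ e l) (he : ∀ j < x, e j = 0) {k : ℕ}
    (hk : ∀ k' ≤ k, ∃ v, (l (x + 1 + k')).val = same v) (i : ℕ) :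
    ∀ j ≤ x + 1 + k, waits i (l j) = decide (j ≤ x) := by
  intro j hj
  by_cases hjx : j ≤ x
  · rw [hl.eq_waiting he j hjx, waits_waiting, decide_eq_true hjx]
  · obtain ⟨k', rfl⟩ := Nat.exists_eq_add_of_lt (not_le.1 hjx)
    obtain ⟨v, hv⟩ := hk k' (by omega)
    rw [show x + k' + 1 = x + 1 + k' by omega] at hjx ⊢
    rw [hv, waits_same, decide_eq_false hjx]

/-- The tile, or the floor, below the tile of round `k` in column `x` with tiles `c`. -/
def below (c : ℕ → Fin W) (x : ℕ) : ℕ → ℕ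
  | 0 => min x 1
  | k + 1 => c k

theorem succ_same (hl : IsPlay σ e l) (hsafe : ∀ j, (l j).val ≠ lost)
    (he : ∀ j < x, e j = 0) {k v : ℕ} (hk : ∀ k' ≤ k, ∃ v, (l (x + 1 + k')).val = same v)
    (hv : (l (x + 1 + k)).val = same v) :
    (column (strategy₀ σ) x k = column (strategy₁ σ) x k ∧
      V v (column (strategy₀ σ) x k) = true) ∧
    (l (x + 1 + (k + 1))).val = same (column (strategy₀ σ) x k) := by
  have hnext := hl.succ (x + 1 + k)
  rw [act_eq_column _ (hl.waits_eq_of_told he hk 0), act_eq_column _ (hl.waits_eq_of_told he hk 1),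
    hv, next_same] at hnext
  split_ifs at hnext with h
  · exact ⟨⟨Fin.ext h.1, h.2⟩, hnext⟩
  · exact absurd hnext (hsafe _)

theorem eq_same (hl : IsPlay σ e l) (hsafe : ∀ j, (l j).val ≠ lost) (he : ∀ j < x, e j = 0)
    (hex : e x = 1) (k : ℕ) :
    (l (x + 1 + k)).val = same (below (column (strategy₀ σ) x) x k) := by
  induction k using Nat.strong_induction_on with
  | _ k ih =>
    cases k with
    | zero =>
      rw [add_zero, hl.succ, hl.eq_waiting he x le_rfl, next_waiting, hex, if_neg one_ne_zero,
        if_pos rfl]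
      rfl
    | succ k =>
      exact (hl.succ_same hsafe he (fun k' hk' => ⟨_, ih k' (by omega)⟩) (ih k (by omega))).2

theorem waits_eq_of_split (hl : IsPlay σ e l) (he : ∀ j < x, e j = 0)
    (hsplit : (l (x + 1)).val = split) (hadj : ∀ k, (l (x + 2 + k)).val = adjacent) (j : ℕ) :
    waits 0 (l j) = decide (j ≤ x) ∧ waits 1 (l j) = decide (j ≤ x + 1) := by
  rcases lt_trichotomy j (x + 1) with hj | rfl | hj
  · rw [hl.eq_waiting he j (by omega), waits_waiting, waits_waiting]
    exact ⟨(decide_eq_true (by omega)).symm, (decide_eq_true (by omega)).symm⟩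
  · simp [hsplit, waits_split]
  · obtain ⟨k, rfl⟩ := Nat.exists_eq_add_of_le (show x + 2 ≤ j from hj)
    rw [hadj, waits_adjacent, waits_adjacent]
    exact ⟨(decide_eq_false (by omega)).symm, (decide_eq_false (by omega)).symm⟩

theorem eq_split (hl : IsPlay σ e l) (he : ∀ j < x, e j = 0) (hex : e x = 2) :
    (l (x + 1)).val = split := by
  rw [hl.succ, hl.eq_waiting he x le_rfl, next_waiting, hex]
  rfl

theorem eq_adjacent (hl : IsPlay σ e l) (hsafe : ∀ j, (l j).val ≠ lost)
    (hsplit : (l (x + 1)).val = split) : ∀ k, (l (x + 2 + k)).val = adjacent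
  | 0 => by rw [add_zero, hl.succ, hsplit, next_split]
  | k + 1 => by
    have hnext := hl.succ (x + 2 + k)
    rw [hl.eq_adjacent hsafe hsplit k, next_adjacent] at hnext
    split_ifs at hnext with h
    · exact hnext
    · exact absurd hnext (hsafe _)

end IsPlay

theorem exists_isPlay_of_winning
    (hσ : ∀ l ∈ (game W hW V H).out (initial hW) σ, ∀ j, (l j).val ≠ lost)
    (x : ℕ) {d : ℕ} (hd : d < 3) :
    ∃ e l, IsPlay σ e l ∧ (∀ j, (l j).val ≠ lost) ∧ (∀ j < x, e j = 0) ∧ e x = d := by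
  obtain ⟨l, hl⟩ := exists_isPlay σ fun j => if j < x then 0 else d
  refine ⟨_, l, hl, hσ l (hl.mem_out fun j => ?_), fun j hj => if_pos hj, if_neg x.lt_irrefl⟩
  split_ifs <;> omega

theorem column_same (hσ : ∀ l ∈ (game W hW V H).out (initial hW) σ, ∀ j, (l j).val ≠ lost)
    (x k : ℕ) :
    column (strategy₀ σ) x k = column (strategy₁ σ) x k ∧
    V (IsPlay.below (column (strategy₀ σ) x) x k) (column (strategy₀ σ) x k) = true := by
  obtain ⟨e, l, hl, hsafe, he, hex⟩ := exists_isPlay_of_winning hσ x (show 1 < 3 by decide)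
  have heq := hl.eq_same hsafe he hex
  exact (hl.succ_same hsafe he (fun k' _ => ⟨_, heq k'⟩) (heq k)).1

theorem column_adjacent (hσ : ∀ l ∈ (game W hW V H).out (initial hW) σ, ∀ j, (l j).val ≠ lost)
    (x k : ℕ) :
    H (column (strategy₀ σ) x (k + 1)) (column (strategy₁ σ) (x + 1) k) = true := by
  obtain ⟨e, l, hl, hsafe, he, hex⟩ := exists_isPlay_of_winning hσ x (show 2 < 3 by decide)
  have hsplit := hl.eq_split he hex
  have hadj := hl.eq_adjacent hsafe hsplit
  have hwaits := hl.waits_eq_of_split he hsplit hadj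
  have hnext := hl.succ (x + 1 + 1 + k)
  rw [act_eq_column (strategy₁ σ) fun j _ => (hwaits j).2, hadj k, next_adjacent,
    show x + 1 + 1 + k = x + 1 + (k + 1) by omega,
    act_eq_column (strategy₀ σ) fun j _ => (hwaits j).1] at hnext
  split_ifs at hnext with h
  · exact h
  · exact absurd hnext (hsafe _)

theorem tileable_of_winnable (h : Winnable W hW V H) : (TileSet.numbered W V H).Tileable := by
  obtain ⟨σ, hσ⟩ := h
  replace hσ : ∀ l ∈ (game W hW V H).out (initial hW) σ, ∀ j, (l j).val ≠ lost := hσ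
  refine ⟨fun x n => column (strategy₀ σ) x (n - x), ?_, fun x => ?_, fun {x n} h => ?_,
    fun {x n} h => ?_⟩
  · exact (column_same hσ 0 0).2
  · rw [Nat.sub_self]
    have hV := (column_same hσ (x + 1) 0).2
    rwa [IsPlay.below, min_eq_right x.succ_pos] at hV
  · rw [Nat.sub_add_comm h]
    exact (column_same hσ x (n - x + 1)).2
  · obtain ⟨k, rfl⟩ := Nat.exists_eq_add_of_lt h
    have hH := column_adjacent hσ x k
    rw [← (column_same hσ (x + 1) k).1] at hH
    rwa [show x + k + 1 - x = k + 1 by omega, show x + k + 1 - (x + 1) = k by omega]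

theorem winnable_iff_tileable : Winnable W hW V H ↔ (TileSet.numbered W V H).Tileable :=
  ⟨tileable_of_winnable, winnable_of_tileable⟩

end TilingGame

namespace TM

/-! ### Runs and tilings -/

variable {Q A : Type} {M : TM Q A}

/-- The new position of a head at position `p` that moves in direction `d`, if there is one. -/
def move : Turing.Dir → ℕ → Option ℕ
  | .right, p => some (p + 1)
  | .left, 0 => none
  | .left, p + 1 => some p

theorem move_eq_some_iff {d : Turing.Dir} {p p' : ℕ} :
    move d p = some p' ↔ d = .right ∧ p' = p + 1 ∨ d = .left ∧ p = p' + 1 := by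
  rcases d with _ | _ <;> rcases p with _ | p <;> simp [move, eq_comm]

theorem move_eq_none_iff {d : Turing.Dir} {p : ℕ} : move d p = none ↔ p = 0 ∧ d = .left := by
  rcases d with _ | _ <;> rcases p with _ | p <;> simp [move]

theorem step_eq (M : TM Q A) (c : Cfg Q A) :
    M.step c = (M.δ c.state (c.tape c.head)).bind fun t =>
      (move t.2.2 c.head).map fun p => ⟨t.1, p, Function.update c.tape c.head t.2.1⟩ := by
  obtain ⟨q, p, tape⟩ := c
  unfold step
  dsimp only
  rcases M.δ q (tape p) with _ | ⟨q', b, _ | _⟩ <;> rcases p with _ | p <;> rfl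

theorem step_eq_some_iff {c c' : Cfg Q A} :
    M.step c = some c' ↔ ∃ q b d p, M.δ c.state (c.tape c.head) = some (q, b, d) ∧
      move d c.head = some p ∧ ⟨q, p, Function.update c.tape c.head b⟩ = c' := by
  simp only [step_eq, Option.bind_eq_some_iff, Option.map_eq_some_iff, Prod.exists]
  tauto

/-- The infinite runs of `M` on the empty word. -/
structure IsRun (M : TM Q A) (r : ℕ → Cfg Q A) : Prop where
  zero : r 0 = M.init
  succ k : M.step (r k) = some (r (k + 1))

theorem exists_isRun (h : ¬ M.Halts) : ∃ r, M.IsRun r := by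
  let r : ℕ → Cfg Q A := Nat.rec M.init fun _ c => (M.step c).getD c
  have step_of_reaches {k : ℕ} (hk : Relation.ReflTransGen (M.step · = some ·) M.init (r k)) :
      M.step (r k) = some (r (k + 1)) := by
    obtain ⟨c, hc⟩ := Option.ne_none_iff_exists'.1 fun hn => h ⟨_, hk, hn⟩
    rw [show r (k + 1) = (M.step (r k)).getD (r k) from rfl, hc, Option.getD_some]
  have reaches (k : ℕ) : Relation.ReflTransGen (M.step · = some ·) M.init (r k) := by
    induction k with
    | zero => exact .refl
    | succ k ih => exact ih.tail (step_of_reaches ih)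
  exact ⟨r, rfl, fun k => step_of_reaches (reaches k)⟩

theorem head_le_succ {c c' : Cfg Q A} (h : M.step c = some c') : c'.head ≤ c.head + 1 := by
  obtain ⟨q, b, d, p, -, hp, rfl⟩ := step_eq_some_iff.1 h
  have := move_eq_some_iff.1 hp
  dsimp only
  omega

theorem tape_eq_of_ne {c c' : Cfg Q A} (h : M.step c = some c') {x : ℕ} (hx : x ≠ c.head) :
    c'.tape x = c.tape x := by
  obtain ⟨q, b, d, p, -, -, rfl⟩ := step_eq_some_iff.1 h
  exact Function.update_of_ne hx _ _

namespace IsRun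

variable {r : ℕ → Cfg Q A}

theorem head_le (hr : M.IsRun r) : ∀ k, (r k).head ≤ k
  | 0 => by rw [hr.zero]; exact le_rfl
  | k + 1 => (head_le_succ (hr.succ k)).trans (Nat.succ_le_succ (hr.head_le k))

theorem tape_eq_blank (hr : M.IsRun r) {x : ℕ} : ∀ {k : ℕ}, k ≤ x → (r k).tape x = M.blank
  | 0, _ => by rw [hr.zero]; rfl
  | k + 1, hk => by
    rw [tape_eq_of_ne (hr.succ k) ((hr.head_le k).trans_lt hk).ne', hr.tape_eq_blank (by omega)]

end IsRun

/-- A tape cell at some time: whether it is the leftmost cell, its symbol, the state and the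
direction of motion of the head if it has just arrived (the initial head counts as having arrived
from the left), and the same data for the head if it has just left. -/
structure Tile (Q A : Type) where
  leftmost : Bool
  sym : A
  arrival : Option (Q × Turing.Dir)
  departure : Option (Q × Turing.Dir)

/-- The state carried by the head if it moves in the direction `d`. -/
def via (d : Turing.Dir) (o : Option (Q × Turing.Dir)) : Option Q :=
  o.bind fun p => if p.2 = d then some p.1 else none

theorem via_ite (d d' : Turing.Dir) (q : Q) (P : Prop) [Decidable P] :
    via d (if P then some (q, d') else none) = if P ∧ d' = d then some q else none := by
  by_cases hP : P <;> simp [via, hP]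

theorem map_fst_eq_via_or (o : Option (Q × Turing.Dir)) :
    o.map Prod.fst = (via .right o).or (via .left o) := by
  rcases o with _ | ⟨q, _ | _⟩ <;> rfl

/-- The symbol and the departure of the tile after `t` of the same cell; there is none if `M`
halts on this cell. -/
def after (M : TM Q A) (t : Tile Q A) : Option (A × Option (Q × Turing.Dir)) :=
  match t.arrival with
  | none => some (t.sym, none)
  | some (q, _) => (M.δ q t.sym).bind fun u =>
      if t.leftmost ∧ u.2.2 = .left then none else some (u.2.1, some (u.1, u.2.2))

/-- The tiles whose tilings are the infinite runs of `M`: the tile at `(x, k)` describes cell `x`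
at time `k`. Cells with `k < x` are still blank and need not be described. -/
def tileSet (M : TM Q A) : TileSet (Tile Q A) where
  corner t := t = ⟨true, M.blank, some (M.start, .right), none⟩
  bottom t := t.leftmost = false ∧ t.sym = M.blank ∧ t.departure = none ∧ via .left t.arrival = none
  above t u := u.leftmost = t.leftmost ∧ M.after t = some (u.sym, u.departure) ∧
    (t.leftmost → via .right u.arrival = none)
  beside t u := via .right u.arrival = via .right t.departure ∧
    via .left t.arrival = via .left u.departure

/-- The direction in which the head has moved to its position at time `k`. -/
def lastDir (r : ℕ → Cfg Q A) : ℕ → Turing.Dir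
  | 0 => .right
  | k + 1 => if (r k).head < (r (k + 1)).head then .right else .left

/-- The tile for cell `x` at time `k` of a run. -/
def runTile (r : ℕ → Cfg Q A) (x k : ℕ) : Tile Q A where
  leftmost := decide (x = 0)
  sym := (r k).tape x
  arrival := if x = (r k).head then some ((r k).state, lastDir r k) else none
  departure := if 1 ≤ k ∧ x = (r (k - 1)).head then some ((r k).state, lastDir r k) else none

namespace IsRun

variable {r : ℕ → Cfg Q A}

theorem delta_eq (hr : M.IsRun r) (k : ℕ) :
    M.δ (r k).state ((r k).tape (r k).head) =
      some ((r (k + 1)).state, (r (k + 1)).tape (r k).head, lastDir r (k + 1)) ∧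
    move (lastDir r (k + 1)) (r k).head = some (r (k + 1)).head := by
  obtain ⟨q, b, d, p, hδ, hp, hr'⟩ := step_eq_some_iff.1 (hr.succ k)
  have hd : lastDir r (k + 1) = d := by
    rw [lastDir, ← hr']
    rcases move_eq_some_iff.1 hp with ⟨rfl, rfl⟩ | ⟨rfl, h⟩
    · simp
    · simp [h]
  rw [hd, ← hr']
  simpa using ⟨hδ, hp⟩

theorem above_runTile (hr : M.IsRun r) (x k : ℕ) :
    M.tileSet.above (runTile r x k) (runTile r x (k + 1)) := by
  obtain ⟨hδ, hp⟩ := hr.delta_eq k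
  refine ⟨rfl, ?_, fun h => ?_⟩
  · by_cases hx : x = (r k).head
    · subst hx
      have hleft : ¬ ((r k).head = 0 ∧ lastDir r (k + 1) = .left) := by
        rw [← move_eq_none_iff, hp]; exact Option.some_ne_none _
      simp [after, runTile, hδ, hleft]
    · simp [after, runTile, hx, tape_eq_of_ne (hr.succ k) hx]
  · obtain rfl : x = 0 := by simpa [runTile] using h
    rcases move_eq_some_iff.1 hp with ⟨-, h⟩ | ⟨hd, -⟩
    · simp [runTile, via, h]
    · simp [runTile, via, hd]

theorem beside_runTile (hr : M.IsRun r) {x k : ℕ} (hk : x < k) :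
    M.tileSet.beside (runTile r x k) (runTile r (x + 1) k) := by
  obtain ⟨k, rfl⟩ := Nat.exists_eq_add_one_of_ne_zero hk.ne_bot
  rcases move_eq_some_iff.1 (hr.delta_eq k).2 with ⟨hd, h⟩ | ⟨hd, h⟩
  · simp [tileSet, runTile, via_ite, hd, h]
  · simp [tileSet, runTile, via_ite, hd, h]

theorem bottom_runTile (hr : M.IsRun r) (x : ℕ) :
    M.tileSet.bottom (runTile r (x + 1) (x + 1)) := by
  have hx : x + 1 ≠ (r x).head := ((hr.head_le x).trans_lt x.lt_succ_self).ne'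
  refine ⟨by simp [runTile], hr.tape_eq_blank le_rfl, by simp [runTile, hx], ?_⟩
  rcases move_eq_some_iff.1 (hr.delta_eq x).2 with ⟨hd, -⟩ | ⟨-, h⟩
  · simp [runTile, via, hd]
  · have hx' : x + 1 ≠ (r (x + 1)).head := by have := hr.head_le x; omega
    simp [runTile, via, hx']

theorem isTiling_runTile (hr : M.IsRun r) : M.tileSet.IsTiling (runTile r) where
  corner := by simp [tileSet, runTile, hr.zero, init, lastDir]
  bottom := hr.bottom_runTile
  above _ := hr.above_runTile _ _
  beside := hr.beside_runTile

end IsRun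

/-- Row `k` of `f` describes the configuration `c`. -/
structure Describes (M : TM Q A) (f : ℕ → ℕ → Tile Q A) (k : ℕ) (c : Cfg Q A) : Prop where
  head_le : c.head ≤ k
  blank {x : ℕ} : k < x → c.tape x = M.blank
  leftmost {x : ℕ} : x ≤ k → (f x k).leftmost = decide (x = 0)
  sym {x : ℕ} : x ≤ k → (f x k).sym = c.tape x
  arrival {x : ℕ} : x ≤ k →
    (f x k).arrival.map Prod.fst = if x = c.head then some c.state else none

namespace Describes

variable {f : ℕ → ℕ → Tile Q A} {k x p : ℕ} {c : Cfg Q A} {q : Q} {b : A} {d : Turing.Dir}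

theorem init (hf : M.tileSet.IsTiling f) : Describes M f 0 M.init := by
  have hcorner : f 0 0 = ⟨true, M.blank, some (M.start, .right), none⟩ := hf.corner
  refine ⟨le_rfl, fun _ => rfl, fun h => ?_, fun h => ?_, fun h => ?_⟩ <;>
    obtain rfl := Nat.le_zero.1 h <;> simp [hcorner, TM.init]

theorem after_head (h : Describes M f k c) :
    M.after (f c.head k) = (M.δ c.state (c.tape c.head)).bind fun u =>
      if c.head = 0 ∧ u.2.2 = .left then none else some (u.2.1, some (u.1, u.2.2)) := by
  obtain ⟨⟨q, d⟩, harr, rfl⟩ := Option.map_eq_some_iff.1 ((h.arrival h.head_le).trans (if_pos rfl))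
  simp [after, harr, h.sym h.head_le, h.leftmost h.head_le]

theorem after_of_ne (h : Describes M f k c) (hx : x ≤ k) (hne : x ≠ c.head) :
    M.after (f x k) = some (c.tape x, none) := by
  have harr := Option.map_eq_none_iff.1 ((h.arrival hx).trans (if_neg hne))
  simp [after, harr, h.sym hx]

theorem exists_step (hf : M.tileSet.IsTiling f) (h : Describes M f k c) :
    ∃ c', M.step c = some c' := by
  have hafter := (hf.above h.head_le).2.1
  rw [h.after_head, Option.bind_eq_some_iff] at hafter
  obtain ⟨⟨q, b, d⟩, hδ, hd⟩ := hafter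
  split_ifs at hd with hleft
  obtain ⟨p, hp⟩ := Option.ne_none_iff_exists'.1 (mt move_eq_none_iff.1 hleft)
  exact ⟨_, step_eq_some_iff.2 ⟨q, b, d, p, hδ, hp, rfl⟩⟩

theorem after_eq (h : Describes M f k c) (hδ : M.δ c.state (c.tape c.head) = some (q, b, d))
    (hp : move d c.head = some p) (hx : x ≤ k) :
    M.after (f x k) = some (Function.update c.tape c.head b x,
      if x = c.head then some (q, d) else none) := by
  by_cases hne : x = c.head
  · subst hne
    have hleft : ¬ (c.head = 0 ∧ d = .left) := by
      rw [← move_eq_none_iff, hp]; exact Option.some_ne_none _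
    rw [h.after_head, hδ, Option.bind_some, if_neg hleft, if_pos rfl, Function.update_self]
  · rw [h.after_of_ne hx hne, Function.update_of_ne hne, if_neg hne]

theorem succ_local (hf : M.tileSet.IsTiling f) (h : Describes M f k c)
    (hδ : M.δ c.state (c.tape c.head) = some (q, b, d)) (hp : move d c.head = some p)
    (hx : x ≤ k + 1) :
    (f x (k + 1)).leftmost = decide (x = 0) ∧
    (f x (k + 1)).sym = Function.update c.tape c.head b x ∧
    (f x (k + 1)).departure = if x = c.head then some (q, d) else none := by
  rcases Nat.lt_or_eq_of_le hx with hx | rfl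
  · obtain ⟨hleftmost, hafter, -⟩ := hf.above (Nat.lt_succ_iff.1 hx)
    rw [h.after_eq hδ hp (Nat.lt_succ_iff.1 hx), Option.some_inj, Prod.ext_iff] at hafter
    exact ⟨hleftmost.trans (h.leftmost (Nat.lt_succ_iff.1 hx)), hafter.1.symm, hafter.2.symm⟩
  · obtain ⟨hleftmost, hsym, hdep, -⟩ := hf.bottom k
    have hne : k + 1 ≠ c.head := (h.head_le.trans_lt k.lt_succ_self).ne'
    rw [hleftmost, hsym, hdep, Function.update_of_ne hne, h.blank k.lt_succ_self, if_neg hne]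
    simp

theorem succ_arrival (hf : M.tileSet.IsTiling f) (h : Describes M f k c)
    (hδ : M.δ c.state (c.tape c.head) = some (q, b, d)) (hp : move d c.head = some p)
    (hx : x ≤ k + 1) :
    (f x (k + 1)).arrival.map Prod.fst = if x = p then some q else none := by
  have hright : via .right (f x (k + 1)).arrival =
      if x = c.head + 1 ∧ d = .right then some q else none := by
    rcases x with _ | x
    · rw [(hf.above k.zero_le).2.2 ((h.leftmost k.zero_le).trans (decide_eq_true rfl)),
        if_neg (by simp)]
    · rw [(hf.beside hx).1, (h.succ_local hf hδ hp (x.le_succ.trans hx)).2.2, via_ite]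
      simp
  have hleft : via .left (f x (k + 1)).arrival =
      if x + 1 = c.head ∧ d = .left then some q else none := by
    rcases Nat.lt_or_eq_of_le hx with hx | rfl
    · rw [(hf.beside hx).2, (h.succ_local hf hδ hp hx).2.2, via_ite]
    · rw [(hf.bottom k).2.2.2, if_neg (by have := h.head_le; omega)]
  rw [map_fst_eq_via_or, hright, hleft]
  rcases move_eq_some_iff.1 hp with ⟨rfl, rfl⟩ | ⟨rfl, hhead⟩
  · simp
  · simp [hhead]

theorem succ (hf : M.tileSet.IsTiling f) (h : Describes M f k c) :
    ∃ c', M.step c = some c' ∧ Describes M f (k + 1) c' := by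
  obtain ⟨c', hc'⟩ := h.exists_step hf
  obtain ⟨q, b, d, p, hδ, hp, rfl⟩ := step_eq_some_iff.1 hc'
  have hlocal {x : ℕ} (hx : x ≤ k + 1) := h.succ_local hf hδ hp hx
  exact ⟨_, hc', (head_le_succ hc').trans (Nat.succ_le_succ h.head_le),
    fun hx => (tape_eq_of_ne hc' (by have := h.head_le; omega)).trans (h.blank (by omega)),
    fun hx => (hlocal hx).1, fun hx => (hlocal hx).2.1, fun hx => h.succ_arrival hf hδ hp hx⟩

end Describes

theorem not_halts_of_tileable (h : M.tileSet.Tileable) : ¬ M.Halts := by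
  obtain ⟨f, hf⟩ := h
  rintro ⟨c, hc, hhalt⟩
  have hdesc : ∃ k, Describes M f k c := by
    clear hhalt
    induction hc with
    | refl => exact ⟨0, .init hf⟩
    | tail _ hstep ih =>
      obtain ⟨k, hk⟩ := ih
      obtain ⟨c', hc', hk'⟩ := hk.succ hf
      obtain rfl := Option.some.inj (hc'.symm.trans hstep)
      exact ⟨k + 1, hk'⟩
  obtain ⟨k, hk⟩ := hdesc
  obtain ⟨c', hc'⟩ := hk.exists_step hf
  exact Option.some_ne_none c' (hc'.symm.trans hhalt)

/-! ### Maps between machines -/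

section

variable {Q A Q' A' : Type} {M : TM Q A} {M' : TM Q' A'} {f : Q → Q'} {g : A → A'}

theorem halts_iff_eval_dom : M.Halts ↔ (StateTransition.eval M.step M.init).Dom := by
  rw [Part.dom_iff_mem]
  exact exists_congr fun c => StateTransition.mem_eval.symm

/-- The configuration `c` with its states and symbols renamed. -/
def Cfg.map (f : Q → Q') (g : A → A') (c : Cfg Q A) : Cfg Q' A' := ⟨f c.state, c.head, g ∘ c.tape⟩

/-- Renaming states by `f` and symbols by `g` turns the transitions of `M` into those of `M'`. The
initial states and the blanks need not correspond. -/
def IsHom (M : TM Q A) (M' : TM Q' A') (f : Q → Q') (g : A → A') : Prop :=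
  ∀ q a, M'.δ (f q) (g a) = (M.δ q a).map (Prod.map f (Prod.map g id))

namespace IsHom

theorem step_map (h : M.IsHom M' f g) (c : Cfg Q A) :
    M'.step (c.map f g) = (M.step c).map (Cfg.map f g) := by
  rw [step_eq, step_eq, show M'.δ (c.map f g).state ((c.map f g).tape (c.map f g).head) = _ from
    h c.state (c.tape c.head)]
  rcases M.δ c.state (c.tape c.head) with _ | ⟨q, b, d⟩
  · rfl
  · rcases hp : move d c.head with _ | p <;> simp [Cfg.map, hp, Function.comp_update]

theorem eval_dom_iff (h : M.IsHom M' f g) (c : Cfg Q A) :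
    (StateTransition.eval M'.step (c.map f g)).Dom ↔ (StateTransition.eval M.step c).Dom := by
  refine StateTransition.tr_eval_dom (StateTransition.fun_respects.2 fun c => ?_) rfl
  have hstep := h.step_map c
  rcases hc : M.step c with _ | c' <;> rw [hc] at hstep
  · exact hstep
  · exact .single hstep

variable (h : M.IsHom M' f g) (hstart : f M.start = M'.start) (hblank : g M.blank = M'.blank)

include hstart hblank in
theorem init_map : M.init.map f g = M'.init := by
  simp only [init, Cfg.map, hstart, ← hblank, Function.comp_def]

include h hstart hblank

theorem halts_iff : M'.Halts ↔ M.Halts := by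
  rw [halts_iff_eval_dom, halts_iff_eval_dom, ← init_map hstart hblank, h.eval_dom_iff]

theorem isRun_map {r : ℕ → Cfg Q A} (hr : M.IsRun r) : M'.IsRun fun k => (r k).map f g where
  zero := by rw [hr.zero, init_map hstart hblank]
  succ k := by rw [h.step_map, hr.succ, Option.map_some]

end IsHom

end

namespace Code

/-- The table entry of `c` for the state `q` and the symbol `a`. -/
def lookup (c : Code) (q a : ℕ) : Option (ℕ × ℕ × Bool) :=
  (c.2.2.2[q]?.bind fun row => row[a]?).bind id

/-- The direction of motion that a letter of a description stands for. -/
def dir (b : Bool) : Turing.Dir := if b then .right else .left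

/-- The machine that is described by `c`. -/
def toTM (c : Code) : TM ℕ ℕ where
  start := c.2.1
  blank := c.2.2.1
  δ q a := (c.lookup q a).map fun t => (t.1, t.2.1, dir t.2.2)

theorem isHom_toTM {n m : ℕ} (M : TM (Fin n) (Fin m)) :
    M.IsHom (toTM M.code) Fin.val Fin.val := by
  intro q a
  simp only [toTM, lookup, TM.code]
  rw [List.getElem?_ofFn, dif_pos q.2, Option.bind_some, List.getElem?_ofFn, dif_pos a.2]
  rcases M.δ q a with _ | ⟨q', b, _ | _⟩ <;> simp [dir]

end Code

end TM

/-! ### Numbering tiles -/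

namespace TileSet

variable {T : Type*}

/-- The tile with the number `v`; the numbers `0` and `1` are reserved for the floor. -/
def tile? (L : List T) (v : ℕ) : Option T := if v < 2 then none else L[v - 2]?

theorem exists_tile?_eq {L : List T} {t : T} (ht : t ∈ L) :
    ∃ v < L.length + 3, tile? L v = some t := by
  obtain ⟨i, hi, rfl⟩ := List.mem_iff_getElem.1 ht
  exact ⟨i + 2, by omega, by simp [tile?, hi]⟩

theorem mem_of_tile?_eq {L : List T} {v : ℕ} {t : T} (h : tile? L v = some t) :
    2 ≤ v ∧ t ∈ L := by
  unfold tile? at h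
  split_ifs at h with hv
  exact ⟨not_lt.1 hv, List.mem_of_getElem? h⟩

open Classical in
/-- The vertical conditions on the numbers of the tiles in `L`. -/
noncomputable def vertTable (𝒯 : TileSet T) (L : List T) (v w : ℕ) : Bool :=
  decide (∃ u ∈ tile? L w, if v = 0 then 𝒯.corner u else if v = 1 then 𝒯.bottom u
    else ∃ t ∈ tile? L v, 𝒯.above t u)

open Classical in
/-- The horizontal conditions on the numbers of the tiles in `L`. -/
noncomputable def horizTable (𝒯 : TileSet T) (L : List T) (v w : ℕ) : Bool :=
  decide (∃ u ∈ tile? L w, ∃ t ∈ tile? L v, 𝒯.beside t u)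

/-- The tiles of `L` with their numbers. There is a spare number, because the tiling game needs
three of them even if `L` is empty. -/
noncomputable abbrev numberedBy (𝒯 : TileSet T) (L : List T) : TileSet (Fin (L.length + 3)) :=
  numbered (L.length + 3) (𝒯.vertTable L) (𝒯.horizTable L)

variable {𝒯 : TileSet T} {L : List T}

theorem numberedBy_corner {v : Fin (L.length + 3)} :
    (𝒯.numberedBy L).corner v ↔ ∃ u ∈ tile? L v, 𝒯.corner u := by
  simp [numberedBy, numbered, vertTable]

theorem numberedBy_bottom {v : Fin (L.length + 3)} :
    (𝒯.numberedBy L).bottom v ↔ ∃ u ∈ tile? L v, 𝒯.bottom u := by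
  simp [numberedBy, numbered, vertTable]

theorem numberedBy_above {v w : Fin (L.length + 3)} (hv : 2 ≤ v.val) :
    (𝒯.numberedBy L).above v w ↔ ∃ u ∈ tile? L w, ∃ t ∈ tile? L v, 𝒯.above t u := by
  have h0 : v.val ≠ 0 := by omega
  have h1 : v.val ≠ 1 := by omega
  simp only [numberedBy, numbered, vertTable, h0, h1, if_false, decide_eq_true_iff]

theorem numberedBy_beside {v w : Fin (L.length + 3)} :
    (𝒯.numberedBy L).beside v w ↔ ∃ u ∈ tile? L w, ∃ t ∈ tile? L v, 𝒯.beside t u := by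
  simp [numberedBy, numbered, horizTable]

theorem exists_tile?_of_above {v w : Fin (L.length + 3)} (h : (𝒯.numberedBy L).above v w) :
    ∃ t, tile? L w = some t := by
  classical exact (of_decide_eq_true h).imp fun _ => And.left

theorem isTiling_numberedBy_iff {f : ℕ → ℕ → T} {c : ℕ → ℕ → Fin (L.length + 3)}
    (hf : ∀ {x n}, x ≤ n → tile? L (c x n) = some (f x n)) :
    (𝒯.numberedBy L).IsTiling c ↔ 𝒯.IsTiling f := by
  have hcorner : (𝒯.numberedBy L).corner (c 0 0) ↔ 𝒯.corner (f 0 0) := by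
    simp [numberedBy_corner, hf le_rfl]
  have hbottom (x : ℕ) :
      (𝒯.numberedBy L).bottom (c (x + 1) (x + 1)) ↔ 𝒯.bottom (f (x + 1) (x + 1)) := by
    simp [numberedBy_bottom, hf le_rfl]
  have habove {x n : ℕ} (h : x ≤ n) :
      (𝒯.numberedBy L).above (c x n) (c x (n + 1)) ↔ 𝒯.above (f x n) (f x (n + 1)) := by
    simp [numberedBy_above (mem_of_tile?_eq (hf h)).1, hf h, hf (h.trans n.le_succ)]
  have hbeside {x n : ℕ} (h : x < n) :
      (𝒯.numberedBy L).beside (c x n) (c (x + 1) n) ↔ 𝒯.beside (f x n) (f (x + 1) n) := by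
    simp [numberedBy_beside, hf h.le, hf (Nat.succ_le_of_lt h)]
  exact ⟨fun h => ⟨hcorner.1 h.corner, fun x => (hbottom x).1 (h.bottom x),
      fun hx => (habove hx).1 (h.above hx), fun hx => (hbeside hx).1 (h.beside hx)⟩,
    fun h => ⟨hcorner.2 h.corner, fun x => (hbottom x).2 (h.bottom x),
      fun hx => (habove hx).2 (h.above hx), fun hx => (hbeside hx).2 (h.beside hx)⟩⟩

theorem exists_tile?_of_isTiling {c : ℕ → ℕ → Fin (L.length + 3)}
    (hc : (𝒯.numberedBy L).IsTiling c) {x n : ℕ} (hx : x ≤ n) :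
    ∃ t, tile? L (c x n) = some t := by
  rcases hx.lt_or_eq with hx | rfl
  · obtain ⟨n, rfl⟩ := Nat.exists_eq_add_one_of_ne_zero hx.ne_bot
    exact exists_tile?_of_above (hc.above (Nat.lt_succ_iff.1 hx))
  · rcases x with _ | x
    · exact (numberedBy_corner.1 hc.corner).imp fun _ => And.left
    · exact (numberedBy_bottom.1 (hc.bottom x)).imp fun _ => And.left

theorem tileable_numberedBy_iff :
    (𝒯.numberedBy L).Tileable ↔ ∃ f, 𝒯.IsTiling f ∧ ∀ x n, x ≤ n → f x n ∈ L := by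
  constructor
  · rintro ⟨c, hc⟩
    obtain ⟨t, -⟩ := exists_tile?_of_isTiling hc le_rfl (x := 0)
    have hf {x n : ℕ} (hx : x ≤ n) : tile? L (c x n) = some ((tile? L (c x n)).getD t) := by
      obtain ⟨u, hu⟩ := exists_tile?_of_isTiling hc hx
      rw [hu, Option.getD_some]
    exact ⟨_, (isTiling_numberedBy_iff hf).1 hc, fun x n hx => (mem_of_tile?_eq (hf hx)).2⟩
  · rintro ⟨f, hf, hL⟩
    have hnum (x n : ℕ) : ∃ v : Fin (L.length + 3), x ≤ n → tile? L v = some (f x n) := by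
      by_cases hx : x ≤ n
      · obtain ⟨v, hv, h⟩ := exists_tile?_eq (hL x n hx)
        exact ⟨⟨v, hv⟩, fun _ => h⟩
      · exact ⟨0, fun h => absurd h hx⟩
    choose c hc using hnum
    exact ⟨c, (isTiling_numberedBy_iff fun {x n} => hc x n).2 hf⟩

end TileSet

/-! ### Computing the tables of the game -/

section

variable {α β : Type*} [Primcodable α] [Primcodable β]

theorem primrecPred_exists_mem_option {o : α → Option β} {P : α → β → Prop} (ho : Primrec o)
    (hP : PrimrecRel P) : PrimrecPred fun x => ∃ u ∈ o x, P x u := by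
  have hP' : PrimrecRel fun u x => P x u := PrimrecPred.comp hP (Primrec.snd.pair .fst)
  refine (hP'.exists_mem_list.comp (Primrec.optionToList.comp ho) .id).of_eq fun x => ?_
  simp [Option.mem_toList]

theorem primrecPred_ite {P Q R : α → Prop} [DecidablePred P] (hP : PrimrecPred P)
    (hQ : PrimrecPred Q) (hR : PrimrecPred R) :
    PrimrecPred fun x => if P x then Q x else R x :=
  ((hP.and hQ).or (hP.not.and hR)).of_eq fun x => by by_cases h : P x <;> simp [h]

end

theorem ofFn_eq_map_range {β : Type*} {n : ℕ} {f : Fin n → β} {g : ℕ → β}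
    (h : ∀ i, f i = g i) : List.ofFn f = (List.range n).map g := by
  apply List.ext_getElem <;> simp [h]

namespace TileSet

theorem primrec_tile? {T : Type*} [Primcodable T] : Primrec₂ (tile? : List T → ℕ → Option T) :=
  .ite (Primrec.nat_lt.comp .snd (.const 2)) (.const none)
    (Primrec.list_getElem?.comp .fst (Primrec.nat_sub.comp .snd (.const 2)))

variable {α T : Type*} [Primcodable α] [Primcodable T] {𝒯 : α → TileSet T} {L : α → List T}
  {v w : α → ℕ}

theorem primrec_vertTable (hcorner : PrimrecRel fun x => (𝒯 x).corner)
    (hbottom : PrimrecRel fun x => (𝒯 x).bottom)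
    (habove : PrimrecPred fun p : α × T × T => (𝒯 p.1).above p.2.1 p.2.2)
    (hL : Primrec L) (hv : Primrec v) (hw : Primrec w) :
    Primrec fun x => (𝒯 x).vertTable (L x) (v x) (w x) := by
  classical
  refine PrimrecPred.decide (primrecPred_exists_mem_option (primrec_tile?.comp hL hw) ?_)
  refine primrecPred_ite (Primrec.eq.comp (hv.comp .fst) (.const 0)) hcorner
    (primrecPred_ite (Primrec.eq.comp (hv.comp .fst) (.const 1)) hbottom
      (primrecPred_exists_mem_option ((primrec_tile?.comp hL hv).comp .fst) ?_))
  exact habove.comp ((Primrec.fst.comp .fst).pair (Primrec.snd.pair (Primrec.snd.comp .fst)))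

theorem primrec_horizTable (hbeside : PrimrecPred fun p : α × T × T => (𝒯 p.1).beside p.2.1 p.2.2)
    (hL : Primrec L) (hv : Primrec v) (hw : Primrec w) :
    Primrec fun x => (𝒯 x).horizTable (L x) (v x) (w x) := by
  classical
  refine PrimrecPred.decide (primrecPred_exists_mem_option (primrec_tile?.comp hL hw)
    (primrecPred_exists_mem_option ((primrec_tile?.comp hL hv).comp .fst) ?_))
  exact hbeside.comp ((Primrec.fst.comp .fst).pair (Primrec.snd.pair (Primrec.snd.comp .fst)))

end TileSet

namespace TM

/-- Directions are coded by bits. -/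
def dirEquiv : Turing.Dir ≃ Bool where
  toFun d := decide (d = .right)
  invFun := Code.dir
  left_inv d := by cases d <;> rfl
  right_inv b := by cases b <;> rfl

instance : Primcodable Turing.Dir := .ofEquiv Bool dirEquiv

/-- Tiles are coded as tuples. -/
def tileEquiv {Q A : Type} :
    Tile Q A ≃ Bool × A × Option (Q × Turing.Dir) × Option (Q × Turing.Dir) where
  toFun t := (t.leftmost, t.sym, t.arrival, t.departure)
  invFun p := ⟨p.1, p.2.1, p.2.2.1, p.2.2.2⟩

instance {Q A : Type} [Primcodable Q] [Primcodable A] : Primcodable (Tile Q A) :=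
  .ofEquiv _ tileEquiv

section

open Primrec

variable {α : Type*} [Primcodable α] {c : α → Code} {t u : α → Tile ℕ ℕ}

theorem primrec_tile_mk {Q A : Type} [Primcodable Q] [Primcodable A] {l : α → Bool} {a : α → A}
    {o o' : α → Option (Q × Turing.Dir)} (hl : Primrec l) (ha : Primrec a) (ho : Primrec o)
    (ho' : Primrec o') : Primrec fun x => (⟨l x, a x, o x, o' x⟩ : Tile Q A) :=
  (of_equiv_symm (e := tileEquiv)).comp (hl.pair (ha.pair (ho.pair ho')))

theorem primrec_leftmost (ht : Primrec t) : Primrec fun x => (t x).leftmost :=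
  fst.comp (of_equiv.comp ht)

theorem primrec_sym (ht : Primrec t) : Primrec fun x => (t x).sym :=
  fst.comp (snd.comp (of_equiv.comp ht))

theorem primrec_arrival (ht : Primrec t) : Primrec fun x => (t x).arrival :=
  fst.comp (snd.comp (snd.comp (of_equiv.comp ht)))

theorem primrec_departure (ht : Primrec t) : Primrec fun x => (t x).departure :=
  snd.comp (snd.comp (snd.comp (of_equiv.comp ht)))

theorem primrec_via (d : Turing.Dir) : Primrec (via d : Option (ℕ × Turing.Dir) → Option ℕ) :=
  option_bind .id (.ite (Primrec.eq.comp (snd.comp snd) (.const d))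
    (option_some.comp (fst.comp snd)) (.const none))

theorem primrec_δ {q a : α → ℕ} (hc : Primrec c) (hq : Primrec q) (ha : Primrec a) :
    Primrec fun x => (c x).toTM.δ (q x) (a x) := by
  have htable : Primrec fun x => (c x).2.2.2 := snd.comp (snd.comp (snd.comp hc))
  have hlookup : Primrec fun x => (c x).lookup (q x) (a x) :=
    option_bind (option_bind (list_getElem?.comp htable hq)
      (list_getElem?.comp .snd (ha.comp .fst))) snd
  exact option_map hlookup ((fst.comp snd).pair
    ((fst.comp (snd.comp snd)).pair ((dom_bool Code.dir).comp (snd.comp (snd.comp snd)))))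

theorem primrec_after (hc : Primrec c) (ht : Primrec t) :
    Primrec fun x => (c x).toTM.after (t x) := by
  have hδ : Primrec fun p : α × ℕ × Turing.Dir => (c p.1).toTM.δ p.2.1 (t p.1).sym :=
    primrec_δ (hc.comp fst) (fst.comp snd) ((primrec_sym ht).comp fst)
  have hdir : Primrec fun p : (α × ℕ × Turing.Dir) × ℕ × ℕ × Turing.Dir => p.2.2.2 :=
    snd.comp (snd.comp snd)
  have hhalts : PrimrecPred fun p : (α × ℕ × Turing.Dir) × ℕ × ℕ × Turing.Dir =>
      (t p.1.1).leftmost = true ∧ p.2.2.2 = Turing.Dir.left :=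
    (Primrec.eq.comp ((primrec_leftmost ht).comp (fst.comp fst)) (.const true)).and
      (Primrec.eq.comp hdir (.const Turing.Dir.left))
  have hhead : Primrec₂ fun (p : α × ℕ × Turing.Dir) (s : ℕ × ℕ × Turing.Dir) =>
      if (t p.1).leftmost = true ∧ s.2.2 = Turing.Dir.left then none
      else some (s.2.1, some (s.1, s.2.2)) :=
    .ite hhalts (.const none) (option_some.comp
      ((fst.comp (snd.comp snd)).pair (option_some.comp ((fst.comp snd).pair hdir))))
  refine (option_casesOn (primrec_arrival ht)
    (option_some.comp ((primrec_sym ht).pair (.const none))) (option_bind hδ hhead).to₂).of_eq ?_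
  intro x
  unfold after
  rcases (t x).arrival <;> rfl

variable (hc : Primrec c) (ht : Primrec t) (hu : Primrec u)

include hc ht

theorem primrecPred_corner : PrimrecPred fun x => (c x).toTM.tileSet.corner (t x) :=
  Primrec.eq.comp ht (primrec_tile_mk (.const true) (fst.comp (snd.comp (snd.comp hc)))
    (option_some.comp ((fst.comp (snd.comp hc)).pair (.const Turing.Dir.right))) (.const none))

theorem primrecPred_bottom : PrimrecPred fun x => (c x).toTM.tileSet.bottom (t x) :=
  (Primrec.eq.comp (primrec_leftmost ht) (.const false)).and
    ((Primrec.eq.comp (primrec_sym ht) (fst.comp (snd.comp (snd.comp hc)))).and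
      ((Primrec.eq.comp (primrec_departure ht) (.const none)).and
        (Primrec.eq.comp ((primrec_via .left).comp (primrec_arrival ht)) (.const none))))

include hu

theorem primrecPred_above : PrimrecPred fun x => (c x).toTM.tileSet.above (t x) (u x) := by
  refine ((Primrec.eq.comp (primrec_leftmost hu) (primrec_leftmost ht)).and
    ((Primrec.eq.comp (primrec_after hc ht) (option_some.comp
      ((primrec_sym hu).pair (primrec_departure hu)))).and
    ((Primrec.eq.comp (primrec_leftmost ht) (.const true)).not.or
      (Primrec.eq.comp ((primrec_via .right).comp (primrec_arrival hu)) (.const none))))).of_eq ?_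
  intro x
  simp only [tileSet, imp_iff_not_or]

omit hc in
theorem primrecPred_beside : PrimrecPred fun x => (c x).toTM.tileSet.beside (t x) (u x) :=
  (Primrec.eq.comp ((primrec_via .right).comp (primrec_arrival hu))
    ((primrec_via .right).comp (primrec_departure ht))).and
  (Primrec.eq.comp ((primrec_via .left).comp (primrec_arrival ht))
    ((primrec_via .left).comp (primrec_departure hu)))

end

/-- What a tile with states `0, …, n - 1` can say about arrival or departure. -/
def moves (n : ℕ) : List (Option (ℕ × Turing.Dir)) :=
  none :: (List.range n).flatMap fun q => [some (q, .left), some (q, .right)]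

/-- The tiles with states `0, …, n - 1` and symbols `0, …, m - 1`. -/
def tiles (n m : ℕ) : List (Tile ℕ ℕ) :=
  [false, true].flatMap fun l => (List.range m).flatMap fun a =>
    (moves n).flatMap fun o => (moves n).map fun o' => ⟨l, a, o, o'⟩

theorem mem_moves {n : ℕ} {o : Option (ℕ × Turing.Dir)} : o ∈ moves n ↔ ∀ p ∈ o, p.1 < n := by
  rcases o with _ | ⟨q, _ | _⟩ <;> simp [moves]

theorem mem_tiles {n m : ℕ} {t : Tile ℕ ℕ} : t ∈ tiles n m ↔
    t.sym < m ∧ t.arrival ∈ moves n ∧ t.departure ∈ moves n := by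
  obtain ⟨l, a, o, o'⟩ := t
  cases l <;> simp [tiles, and_left_comm]

theorem runTile_map_mem_tiles {n m : ℕ} (r : ℕ → Cfg (Fin n) (Fin m)) (x k : ℕ) :
    runTile (fun k => (r k).map Fin.val Fin.val) x k ∈ tiles n m := by
  refine mem_tiles.2 ⟨((r k).tape x).2, mem_moves.2 ?_, mem_moves.2 ?_⟩ <;>
  · intro p hp
    simp only [runTile, Option.mem_def, Option.ite_none_right_eq_some, Option.some_inj] at hp
    rw [← hp.2]
    exact (r k).state.2

theorem tileable_numberedBy_tiles_iff {n m : ℕ} (M : TM (Fin n) (Fin m)) :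
    ((Code.toTM M.code).tileSet.numberedBy (tiles n m)).Tileable ↔ ¬ M.Halts := by
  have hom := Code.isHom_toTM M
  rw [TileSet.tileable_numberedBy_iff]
  refine ⟨fun ⟨f, hf, _⟩ => ?_, fun h => ?_⟩
  · rw [← hom.halts_iff rfl rfl]
    exact not_halts_of_tileable ⟨f, hf⟩
  · obtain ⟨r, hr⟩ := exists_isRun h
    exact ⟨_, (hom.isRun_map rfl rfl hr).isTiling_runTile, fun x k _ => runTile_map_mem_tiles r x k⟩

open Primrec in
theorem primrec_moves : Primrec moves :=
  list_cons.comp (.const none) (list_flatMap list_range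
    (list_cons.comp (option_some.comp (snd.pair (.const Turing.Dir.left)))
      (list_cons.comp (option_some.comp (snd.pair (.const Turing.Dir.right))) (.const []))))

open Primrec in
theorem primrec_tiles : Primrec₂ tiles := by
  have hmoves : Primrec fun p : ℕ × ℕ => moves p.1 := primrec_moves.comp fst
  refine list_flatMap (.const _) ?_
  refine list_flatMap (list_range.comp (snd.comp fst)) ?_
  refine list_flatMap (hmoves.comp (fst.comp fst)) ?_
  refine list_map (hmoves.comp (fst.comp (fst.comp fst))) ?_
  refine primrec_tile_mk ?_ ?_ ?_ snd
  · exact snd.comp (fst.comp (fst.comp fst))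
  · exact snd.comp (fst.comp fst)
  · exact snd.comp fst

end TM

namespace TilingGame

section

open Primrec

variable {α : Type*} [Primcodable α] {V H : α → ℕ → ℕ → Bool}

theorem primrec_same : Primrec same := succ.comp (nat_mul.comp (.const 5) .id)

theorem primrec_next (hV : Primrec fun p : α × ℕ × ℕ => V p.1 p.2.1 p.2.2)
    (hH : Primrec fun p : α × ℕ × ℕ => H p.1 p.2.1 p.2.2) {s a b e : α → ℕ} (hs : Primrec s)
    (ha : Primrec a) (hb : Primrec b) (he : Primrec e) :
    Primrec fun x => next (V x) (H x) (s x) (a x) (b x) (e x) := by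
  have hkind k : PrimrecPred fun x => s x % 5 = k :=
    Primrec.eq.comp (nat_mod.comp hs (.const 5)) (.const k)
  have hvalue : Primrec fun x => s x / 5 := nat_div.comp hs (.const 5)
  have hVx : Primrec fun x => V x (s x / 5) (a x) := hV.comp (Primrec.id.pair (hvalue.pair ha))
  have hHx : Primrec fun x => H x (a x) (b x) := hH.comp (Primrec.id.pair (ha.pair hb))
  refine .ite (hkind 0) (.ite (Primrec.eq.comp he (.const 0)) (.const (waiting 1))
    (.ite (Primrec.eq.comp he (.const 1)) (primrec_same.comp hvalue) (.const split))) ?_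
  refine .ite (hkind 1) (.ite ((Primrec.eq.comp ha hb).and (Primrec.eq.comp hVx (.const true)))
    (primrec_same.comp ha) (.const lost)) ?_
  exact .ite (hkind 2) (.const adjacent) (.ite (hkind 3)
    (.ite (Primrec.eq.comp hHx (.const true)) (.const adjacent) (.const lost)) (.const lost))

theorem primrec_waits : Primrec₂ waits := by
  have hkind : Primrec fun p : ℕ × ℕ => p.2 % 5 := nat_mod.comp snd (.const 5)
  exact ((Primrec.eq.comp hkind (.const 0)).or ((Primrec.eq.comp fst (.const 1)).and
    (Primrec.eq.comp hkind (.const 2)))).decide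

end

/-- The description of the game, its initial state and the formula `⟨⟨0, 1⟩⟩ □ ok`. -/
def description (W : ℕ) (V H : ℕ → ℕ → Bool) : InstanceCode :=
  ((3, 5 * W, 1, W),
    (List.range (5 * W)).map (fun s => [decide (s ≠ lost)]),
    (List.range 3).map (fun i => (List.range (5 * W)).map fun s =>
      (List.range (5 * W)).map fun t => decide (waits i s = waits i t)),
    (List.range 3).map (fun _ => (List.range (5 * W)).map fun _ =>
      (List.range W).map fun _ => true),
    (List.range (5 * W)).map (fun s => (List.range (W ^ 3)).map fun x =>
      some (next V H s (x % W) (x / W % W) (x / W ^ 2 % W))),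
    waiting 0, [4, 1, 1, 0, 0, 0])

open Primrec in
theorem primrec_description {α : Type*} [Primcodable α] {W : α → ℕ} {V H : α → ℕ → ℕ → Bool}
    (hW : Primrec W) (hV : Primrec fun p : α × ℕ × ℕ => V p.1 p.2.1 p.2.2)
    (hH : Primrec fun p : α × ℕ × ℕ => H p.1 p.2.1 p.2.2) :
    Primrec fun x => description (W x) (V x) (H x) := by
  have hnum : Primrec fun x => 5 * W x := nat_mul.comp (.const 5) hW
  have hstates : Primrec fun x => List.range (5 * W x) := list_range.comp hnum
  have hWW : Primrec fun x => W x ^ 2 := (nat_mul.comp hW hW).of_eq fun x => (sq _).symm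
  have hWWW : Primrec fun x => W x ^ 3 := nat_mul.comp hWW hW
  refine (Primrec.pair (.const 3) (hnum.pair (.pair (.const 1) hW))).pair
    (.pair ?label (.pair ?obs (.pair ?avail (.pair ?trans (.const _)))))
  case label =>
    exact list_map hstates (list_cons.comp
      (Primrec.eq.comp snd (.const lost)).not.decide (.const []))
  case obs =>
    exact list_map (.const _) (list_map (hstates.comp fst) (list_map (hstates.comp (fst.comp fst))
      (Primrec.eq.comp (primrec_waits.comp (snd.comp (fst.comp fst)) (snd.comp fst))
        (primrec_waits.comp (snd.comp (fst.comp fst)) snd)).decide))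
  case avail =>
    exact list_map (.const _) (list_map (hstates.comp fst)
      (list_map (list_range.comp (hW.comp (fst.comp fst))) (.const true)))
  case trans =>
    have hx : Primrec fun y : (α × ℕ) × ℕ => y.1.1 := fst.comp fst
    refine list_map hstates (list_map (list_range.comp (hWWW.comp fst)) (option_some.comp ?_))
    exact primrec_next (V := fun y : (α × ℕ) × ℕ => V y.1.1) (H := fun y => H y.1.1)
      (hV.comp ((hx.comp fst).pair snd)) (hH.comp ((hx.comp fst).pair snd))
      (snd.comp fst) (nat_mod.comp snd (hW.comp hx))
      (nat_mod.comp (nat_div.comp snd (hW.comp hx)) (hW.comp hx))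
      (nat_mod.comp (nat_div.comp snd (hWW.comp hx)) (hW.comp hx))

theorem code_game {W : ℕ} {hW : 3 ≤ W} {V H : ℕ → ℕ → Bool} :
    Instance.code
      { numAgents := 3, numStates := 5 * W, numProps := 1, numActs := W
        agents_pos := by decide
        states_pos := by omega, props_pos := by decide, acts_pos := by omega
        G := game W hW V H, state := initial hW
        formula := .globally {0, 1} (by simp) (.atom 0) } = description W V H := by
  refine congrArg₂ Prod.mk rfl (congrArg₂ Prod.mk ?label (congrArg₂ Prod.mk ?obs
    (congrArg₂ Prod.mk ?avail (congrArg₂ Prod.mk ?trans (congrArg₂ Prod.mk rfl ?formula)))))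
  case label =>
    exact ofFn_eq_map_range fun s => by by_cases h : s.val = lost <;> simp [game, h]
  case obs =>
    exact ofFn_eq_map_range fun i => ofFn_eq_map_range fun s => ofFn_eq_map_range fun t => by
      simp [obs_iff]
  case avail =>
    exact ofFn_eq_map_range fun i => ofFn_eq_map_range fun s => ofFn_eq_map_range fun t => by
      simp [game]
  case trans =>
    exact ofFn_eq_map_range fun s => ofFn_eq_map_range fun x => by simp [game, finFunctionFinEquiv]
  case formula => simp [Formula.code, List.ofFn_succ]

end TilingGame

/-- The reduction on the level of descriptions. -/
noncomputable def reduction (c : TM.Code) : InstanceCode :=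
  let L := TM.tiles c.1.1 c.1.2
  TilingGame.description (L.length + 3) (c.toTM.tileSet.vertTable L) (c.toTM.tileSet.horizTable L)

open Primrec in
theorem primrec_reduction : Primrec reduction := by
  have hL : Primrec fun c : TM.Code => TM.tiles c.1.1 c.1.2 :=
    TM.primrec_tiles.comp (fst.comp fst) (snd.comp fst)
  have hv : Primrec fun p : TM.Code × ℕ × ℕ => p.2.1 := fst.comp snd
  have hw : Primrec fun p : TM.Code × ℕ × ℕ => p.2.2 := snd.comp snd
  have hc : Primrec fun p : (TM.Code × ℕ × ℕ) × TM.Tile ℕ ℕ => p.1.1 := fst.comp fst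
  have hcc : Primrec fun p : (TM.Code × ℕ × ℕ) × TM.Tile ℕ ℕ × TM.Tile ℕ ℕ => p.1.1 :=
    fst.comp fst
  have ht : Primrec fun p : (TM.Code × ℕ × ℕ) × TM.Tile ℕ ℕ × TM.Tile ℕ ℕ => p.2.1 := fst.comp snd
  have hu : Primrec fun p : (TM.Code × ℕ × ℕ) × TM.Tile ℕ ℕ × TM.Tile ℕ ℕ => p.2.2 := snd.comp snd
  have hV := TileSet.primrec_vertTable (𝒯 := fun p : TM.Code × ℕ × ℕ => p.1.toTM.tileSet)
    (TM.primrecPred_corner hc snd) (TM.primrecPred_bottom hc snd) (TM.primrecPred_above hcc ht hu)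
    (hL.comp fst) hv hw
  have hH := TileSet.primrec_horizTable (𝒯 := fun p : TM.Code × ℕ × ℕ => p.1.toTM.tileSet)
    (TM.primrecPred_beside ht hu) (hL.comp fst) hv hw
  exact TilingGame.primrec_description (nat_add.comp (list_length.comp hL) (.const 3)) hV hH

theorem reduction_correct {n m : ℕ} (M : TM (Fin n) (Fin m)) :
    ∃ (S P Act : ℕ) (hS : 0 < S) (hP : 0 < P) (hAct : 0 < Act)
      (G : CGS (Fin 3) (Fin S) (Fin P) (Fin Act)) (sInit : Fin S) (ok : Fin P),
      reduction M.code = Instance.code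
        { numAgents := 3, numStates := S, numProps := P, numActs := Act
          agents_pos := by decide
          states_pos := hS, props_pos := hP, acts_pos := hAct
          G := G, state := sInit
          formula := .globally {0, 1} (by simp) (.atom ok) } ∧
      (¬ M.Halts ↔ G.Sat sInit (.globally {0, 1} (by simp) (.atom ok))) :=
  have hW : 3 ≤ (TM.tiles n m).length + 3 := Nat.le_add_left ..
  ⟨_, 1, _, by omega, by decide, by omega, TilingGame.game _ hW _ _, TilingGame.initial hW, 0,
    TilingGame.code_game.symm,
    (TM.tileable_numberedBy_tiles_iff M).symm.trans TilingGame.winnable_iff_tileable.symm⟩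

/-! ### Finite machines for partial recursive functions -/

section

open Turing

instance : Finite PartrecToTM2.K' :=
  .of_surjective (α := Fin 4) ![.main, .rev, .aux, .stack] fun k => by
    cases k
    exacts [⟨0, rfl⟩, ⟨1, rfl⟩, ⟨2, rfl⟩, ⟨3, rfl⟩]

instance {K : Type} {Γ : K → Type} [Finite K] [∀ k, Finite (Γ k)] : Finite (TM2to1.Γ' K Γ) :=
  inferInstanceAs (Finite (Bool × ∀ k, Option (Γ k)))

theorem exists_machine_of_supports {Γ Λ : Type} [Inhabited Γ] [Inhabited Λ] {M : TM0.Machine Γ Λ}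
    {S : Set Λ} (hS : TM0.Supports M S) : ∃ (_ : Inhabited S) (M' : TM0.Machine Γ S),
      ∀ l, (TM0.eval M' l).Dom ↔ (TM0.eval M l).Dom := by
  classical
  let _ : Inhabited S := ⟨⟨default, hS.1⟩⟩
  let retract : PointedMap Λ S :=
    ⟨fun q => if hq : q ∈ S then ⟨q, hq⟩ else default, dif_pos hS.1⟩
  have hretract : ∀ q ∈ S, (retract q : Λ) = q := fun q hq =>
    congrArg Subtype.val (dif_pos hq)
  let ident : PointedMap Γ Γ := ⟨id, rfl⟩
  refine ⟨inferInstance, M.map ident ident retract Subtype.val, fun l => ?_⟩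
  refine StateTransition.tr_eval_dom (a₁ := TM0.init l) (TM0.Machine.map_respects M ident ident
    retract Subtype.val hS (fun _ => rfl) hretract) ⟨hS.1, ?_⟩
  rw [TM0.map_init]
  exact congrArg _ (List.map_id l)

theorem exists_machine_of_stackMachine {K Λ σ : Type} {Γ : K → Type} [DecidableEq K] [Inhabited Λ]
    [Inhabited σ] [Finite σ] {M : Λ → TM2.Stmt Γ Λ σ} {S : Finset Λ} (hS : TM2.Supports M S)
    (k : K) :
    ∃ (Λ' : Type) (_ : Inhabited Λ') (_ : Finite Λ') (M' : TM0.Machine (TM2to1.Γ' K Γ) Λ'),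
      ∀ L, (TM0.eval M' (TM2to1.trInit k L)).Dom ↔ (TM2.eval M k L).Dom := by
  let _ := Fintype.ofFinite σ
  obtain ⟨hi, M', hM'⟩ :=
    exists_machine_of_supports (TM1to0.tr_supports _ (TM2to1.tr_supports M hS))
  refine ⟨_, hi, Finset.finite_toSet _, M', fun L => ?_⟩
  rw [hM', TM1to0.tr_eval, TM2to1.tr_eval_dom]

theorem trNat_two_pow (k : ℕ) :
    PartrecToTM2.trNat (2 ^ k) = List.replicate k .bit0 ++ [.bit1] := by
  have h : ∃ p : PosNum, ((2 ^ k : ℕ) : Num) = .pos p ∧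
      PartrecToTM2.trPosNum p = List.replicate k .bit0 ++ [.bit1] := by
    induction k with
    | zero => exact ⟨.one, rfl, rfl⟩
    | succ k ih =>
      obtain ⟨p, hp, ht⟩ := ih
      refine ⟨.bit0 p, ?_, by rw [PartrecToTM2.trPosNum, ht]; rfl⟩
      rw [pow_succ', two_mul, Nat.cast_add, hp, Num.bit0_of_bit0]
      rfl
  obtain ⟨p, hp, ht⟩ := h
  rw [PartrecToTM2.trNat, hp, ← ht]
  rfl

theorem init_main_trList (c : ToPartrec.Code) (v : List ℕ) :
    letI : Inhabited PartrecToTM2.Λ' := ⟨PartrecToTM2.trNormal c .halt⟩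
    (TM2.init .main (PartrecToTM2.trList v) : PartrecToTM2.Cfg') = PartrecToTM2.init c v := by
  refine congrArg (TM2.Cfg.mk _ _) (funext fun k => ?_)
  cases k <;> rfl

/-- The letter of the one-tape simulation for the letter `a` on the main stack; `bottom` marks the
bottom cell of the stacks. -/
def mainLetter (bottom : Bool) (a : PartrecToTM2.Γ') :
    TM2to1.Γ' PartrecToTM2.K' fun _ => PartrecToTM2.Γ' :=
  (bottom, Function.update (fun _ => none) .main (some a))

theorem trInit_two_pow (k : ℕ) :
    TM2to1.trInit (Γ := fun _ => PartrecToTM2.Γ') .main (PartrecToTM2.trList [2 ^ k]) =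
      [mainLetter true .cons, mainLetter false .bit1] ++
        List.replicate k (mainLetter false .bit0) := by
  have h : (PartrecToTM2.trList [2 ^ k]).reverse = .cons :: .bit1 :: List.replicate k .bit0 := by
    simp [trNat_two_pow]
  rw [TM2to1.trInit, h, ← List.map_replicate]
  rfl

theorem primrec_log_two : Primrec (Nat.log 2) := by
  have hpow : Primrec₂ ((· ^ ·) : ℕ → ℕ → ℕ) := Primrec₂.unpaired'.1 Nat.Primrec.pow
  have hle : PrimrecRel fun x k => 2 ^ k ≤ x :=
    Primrec.nat_le.comp (hpow.comp (.const 2) .snd) .fst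
  refine (Primrec.nat_findGreatest .id hle).of_eq fun x => ?_
  rcases eq_or_ne x 0 with rfl | hx
  · simp
  · exact Nat.findGreatest_eq_iff.2 ⟨Nat.log_le_self 2 x, fun _ => Nat.pow_log_le_self 2 hx,
      fun k hk _ => (Nat.lt_pow_of_log_lt one_lt_two hk).not_ge⟩

theorem exists_machine_of_partrec {f : ℕ →. ℕ} (hf : Partrec f) :
    ∃ (Γ Λ : Type) (_ : Inhabited Γ) (_ : Inhabited Λ) (_ : Finite Γ) (_ : Finite Λ)
      (M : TM0.Machine Γ Λ) (l : List Γ) (a : Γ),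
      ∀ k, (TM0.eval M (l ++ List.replicate k a)).Dom ↔ (f k).Dom := by
  have hg : Partrec fun x => f (Nat.log 2 x) := hf.comp primrec_log_two.to_comp
  obtain ⟨c, hc⟩ := ToPartrec.Code.exists_code (Nat.Partrec'.part_iff₁.2 hg)
  let _ : Inhabited PartrecToTM2.Λ' := ⟨PartrecToTM2.trNormal c .halt⟩
  obtain ⟨Λ, hΛ, hfin, M, hM⟩ :=
    exists_machine_of_stackMachine (PartrecToTM2.tr_supports c .halt) PartrecToTM2.K'.main
  refine ⟨_, Λ, inferInstance, hΛ, inferInstance, hfin, M,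
    [mainLetter true .cons, mainLetter false .bit1], mainLetter false .bit0, fun k => ?_⟩
  have heval : (TM2.eval PartrecToTM2.tr .main (PartrecToTM2.trList [2 ^ k])).Dom ↔
      (c.eval [2 ^ k]).Dom := by
    have h := PartrecToTM2.tr_eval c [2 ^ k]
    rw [← init_main_trList] at h
    exact iff_of_eq (congrArg Part.Dom h)
  have hck : c.eval [2 ^ k] = pure <$> f k := by
    rw [hc ⟨[2 ^ k], rfl⟩]
    exact congrArg (fun i => pure <$> f i) (Nat.log_pow one_lt_two k)
  rw [← trInit_two_pow, hM, heval, hck]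
  rfl

end

theorem TM.step_eq_of_δ_eq {Q A : Type} {M : TM Q A} {c : TM.Cfg Q A} {q : Q} {d : Turing.Dir}
    {p : ℕ} (hδ : M.δ c.state (c.tape c.head) = some (q, c.tape c.head, d))
    (hp : TM.move d c.head = some p) : M.step c = some ⟨q, p, c.tape⟩ :=
  TM.step_eq_some_iff.2 ⟨q, _, d, p, hδ, hp, by rw [Function.update_eq_self]⟩

/-! ### Folding a two-sided tape -/

namespace Fold

open Turing StateTransition

/-- States of the simulation of a two-sided tape, folded between the cells `-1` and `0`: `rewind`
moves the head to the left end, `sim q side` is about to simulate a step in the state `q`, and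
`back q side` still has to undo a move to the right. The right half of the tape is visited if
`side` is `true`. -/
inductive State (Λ : Type) : Type
  | rewind
  | sim (q : Λ) (side : Bool)
  | back (q : Λ) (side : Bool)

instance {Λ : Type} [Finite Λ] : Finite (State Λ) :=
  .of_surjective (α := Option (Λ × Bool) ⊕ Λ × Bool)
    (Sum.elim (fun o => o.elim .rewind fun p => .sim p.1 p.2) fun p => .back p.1 p.2) <| by
    rintro (_ | ⟨q, side⟩ | ⟨q, side⟩)
    exacts [⟨.inl none, rfl⟩, ⟨.inl (some (q, side)), rfl⟩, ⟨.inr (q, side), rfl⟩]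

/-- Symbols of the folded tape: the marker `none` in the leftmost cell, and the pairs of a symbol
of the right half and a symbol of the left half in all other cells. -/
abbrev Sym (Γ : Type) : Type := Option (Γ × Γ)

variable {Γ Λ : Type}

/-- The symbol of the visited half. -/
def track (side : Bool) (u : Γ × Γ) : Γ := if side then u.1 else u.2

/-- The pair `u` with the symbol of the visited half replaced by `c`. -/
def setTrack (side : Bool) (c : Γ) (u : Γ × Γ) : Γ × Γ := if side then (c, u.2) else (u.1, c)

theorem track_setTrack (side side' : Bool) (c : Γ) (u : Γ × Γ) :
    track side (setTrack side' c u) = if side = side' then c else track side u := by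
  cases side <;> cases side' <;> rfl

/-- The direction on the folded tape of a motion in direction `d` on the two-sided tape. -/
def turn : Bool → Dir → Dir
  | true, d => d
  | false, .left => .right
  | false, .right => .left

/-- The displacement of the head. -/
def shift : Dir → ℤ
  | .left => -1
  | .right => 1

/-- The cell of the two-sided tape that is stored in the cell `j + 1` of the folded tape. -/
def pos (side : Bool) (j : ℕ) : ℤ := if side then j else -j - 1

theorem pos_eq_pos_iff {side side' : Bool} {i j : ℕ} :
    pos side i = pos side' j ↔ side = side' ∧ i = j := by
  cases side <;> cases side' <;> simp only [pos] <;> simp <;> omega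

theorem pos_add_shift_of_turn_eq_right {side : Bool} {d : Dir} (h : turn side d = .right) (j : ℕ) :
    pos side j + shift d = pos side (j + 1) := by
  cases side <;> cases d <;> simp_all [turn, pos, shift]
  ring

theorem pos_succ_add_shift_of_turn_eq_left {side : Bool} {d : Dir} (h : turn side d = .left)
    (j : ℕ) : pos side (j + 1) + shift d = pos side j := by
  cases side <;> cases d <;> simp_all [turn, pos, shift]
  ring

theorem pos_zero_add_shift_of_turn_eq_left {side : Bool} {d : Dir} (h : turn side d = .left) :
    pos side 0 + shift d = pos (!side) 0 := by
  cases side <;> cases d <;> simp_all [turn, pos, shift]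

variable [Inhabited Γ]

/-- The folded tape `t` represents the two-sided tape `T`, whose head is in the cell `p`. -/
structure IsFold (T : Tape Γ) (p : ℤ) (t : ℕ → Sym Γ) : Prop where
  zero : t 0 = none
  succ side i : (t (i + 1)).map (track side) = some (T.nth (pos side i - p))

namespace IsFold

variable {T : Tape Γ} {p : ℤ} {t : ℕ → Sym Γ}

theorem move (h : IsFold T p t) (d : Dir) : IsFold (T.move d) (p + shift d) t where
  zero := h.zero
  succ side i := by
    rw [h.succ]
    cases d
    · rw [Tape.move_left_nth, shift]
      congr 2
      ring
    · rw [Tape.move_right_nth, shift]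
      congr 2
      ring

variable {side : Bool} {j : ℕ}

theorem read (h : IsFold T (pos side j) t) : ∃ u, t (j + 1) = some u ∧ track side u = T.head := by
  have := h.succ side j
  rwa [sub_self, Tape.nth_zero, Option.map_eq_some_iff] at this

theorem write (h : IsFold T (pos side j) t) {u : Γ × Γ} (hu : t (j + 1) = some u) (c : Γ) :
    IsFold (T.write c) (pos side j)
      (Function.update t (j + 1) (some (setTrack side c u))) where
  zero := by rw [Function.update_of_ne (by omega), h.zero]
  succ side' i := by
    have hi := h.succ side' i
    simp only [Tape.write_nth, sub_eq_zero, pos_eq_pos_iff]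
    rcases eq_or_ne i j with rfl | hij
    · rw [hu, Option.map_some, Option.some_inj] at hi
      simp only [Function.update_self, Option.map_some, track_setTrack, hi, and_true]
    · rw [Function.update_of_ne (by omega), hi, if_neg (fun h => hij h.2)]

end IsFold

variable [Inhabited Λ]

/-- The simulation of `M` on a tape that is infinite to the right only. -/
def machine (M : TM0.Machine Γ Λ) : TM (State Λ) (Sym Γ) where
  start := .rewind
  blank := some (default, default)
  δ
    | .rewind, none => some (.sim default true, none, .right)
    | .rewind, some u => some (.rewind, some u, .left)
    | .sim q side, none => some (.sim q !side, none, .right)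
    | .sim q side, some u => (M q (track side u)).map fun t =>
      match t with
      | (q', .move d) => (.sim q' side, some u, turn side d)
      | (q', .write c) => (.back q' side, some (setTrack side c u), .right)
    | .back q side, x => some (.sim q side, x, .left)

/-- The folded tape with the input `l`. -/
def input (l : List Γ) : ℕ → Sym Γ
  | 0 => none
  | i + 1 => some (l.getI i, default)

variable {M : TM0.Machine Γ Λ}

theorem reaches_rewind (l : List Γ) (i : ℕ) :
    Reaches (machine M).step ⟨.rewind, i, input l⟩ ⟨.sim default true, 1, input l⟩ := by
  induction i with
  | zero => exact .single (TM.step_eq_of_δ_eq rfl rfl)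
  | succ i ih => exact ih.head (TM.step_eq_of_δ_eq rfl rfl)

/-- The configuration `d` of the simulation represents the configuration `c`. -/
def Represents (c : TM0.Cfg Γ Λ) (d : TM.Cfg (State Λ) (Sym Γ)) : Prop :=
  ∃ side j t, IsFold c.Tape (pos side j) t ∧ d = ⟨.sim c.q side, j + 1, t⟩

theorem represents_init (l : List Γ) :
    Represents (TM0.init l : TM0.Cfg Γ Λ) ⟨.sim default true, 1, input l⟩ := by
  refine ⟨true, 0, input l, ⟨rfl, fun side i => ?_⟩, rfl⟩
  have h0 : pos true 0 = 0 := rfl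
  rw [input, Option.map_some, h0, sub_zero, Option.some_inj]
  cases side
  · have hpos : pos false i = Int.negSucc i := by
      simp only [pos, Int.negSucc_eq, Bool.false_eq_true, if_false]
      ring
    rw [hpos]
    change default = (ListBlank.mk []).nth i
    rw [ListBlank.nth_mk, List.getI_nil]
  · change l.getI i = (Tape.mk₁ l).nth i
    rw [Tape.mk₁, Tape.mk₂, Tape.mk'_nth_nat, ListBlank.nth_mk]

variable {q q' : Λ} {side : Bool} {j : ℕ} {t : ℕ → Sym Γ} {T : Tape Γ}

theorem exists_represents_reaches {d : Dir} (h : IsFold T (pos side j + shift d) t) {p : ℕ}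
    (hp : TM.move (turn side d) (j + 1) = some p) :
    ∃ b, Represents ⟨q, T⟩ b ∧ Reaches (machine M).step ⟨.sim q side, p, t⟩ b := by
  rcases TM.move_eq_some_iff.1 hp with ⟨hd, rfl⟩ | ⟨hd, hj⟩
  · rw [pos_add_shift_of_turn_eq_right hd] at h
    exact ⟨_, ⟨side, j + 1, t, h, rfl⟩, .refl⟩
  obtain rfl : j = p := Nat.succ.inj hj
  rcases j with _ | j
  · rw [pos_zero_add_shift_of_turn_eq_left hd] at h
    refine ⟨_, ⟨!side, 0, t, h, rfl⟩, .single (TM.step_eq_of_δ_eq (d := .right) ?_ rfl)⟩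
    simp only [machine, h.zero]
  · rw [pos_succ_add_shift_of_turn_eq_left hd] at h
    exact ⟨_, ⟨side, j, t, h, rfl⟩, .refl⟩

theorem exists_represents_reaches_move (h : IsFold T (pos side j) t) {d : Dir}
    (hM : M q T.head = some (q', .move d)) :
    ∃ b, Represents ⟨q', T.move d⟩ b ∧
      Reaches₁ (machine M).step ⟨.sim q side, j + 1, t⟩ b := by
  obtain ⟨u, hu, hhead⟩ := h.read
  obtain ⟨p, hp⟩ : ∃ p, TM.move (turn side d) (j + 1) = some p :=
    Option.ne_none_iff_exists'.1 fun hn => j.succ_ne_zero (TM.move_eq_none_iff.1 hn).1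
  obtain ⟨b, hb, hreach⟩ := exists_represents_reaches (M := M) (q := q') (h.move d) hp
  refine ⟨b, hb, .head' (TM.step_eq_of_δ_eq ?_ hp) hreach⟩
  simp only [machine, hu, hhead, hM, Option.map_some]

theorem exists_represents_reaches_write (h : IsFold T (pos side j) t) {c : Γ}
    (hM : M q T.head = some (q', .write c)) :
    ∃ b, Represents ⟨q', T.write c⟩ b ∧
      Reaches₁ (machine M).step ⟨.sim q side, j + 1, t⟩ b := by
  obtain ⟨u, hu, hhead⟩ := h.read
  refine ⟨_, ⟨side, j, _, h.write hu c, rfl⟩,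
    .head (TM.step_eq_some_iff.2 ⟨.back q' side, _, .right, _, ?_, rfl, rfl⟩)
      (.single (TM.step_eq_of_δ_eq rfl rfl))⟩
  simp only [machine, hu, hhead, hM, Option.map_some]

theorem respects : Respects (TM0.step M) (machine M).step Represents := by
  rintro ⟨q, T⟩ _ ⟨side, j, t, h, rfl⟩
  rcases hM : M q T.head with _ | ⟨q', d | c⟩ <;>
    simp only [TM0.step, hM, Option.map_none, Option.map_some]
  · obtain ⟨u, hu, hhead⟩ := h.read
    simp only [TM.step_eq, machine, hu, hhead, hM, Option.map_none, Option.bind_none]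
  · exact exists_represents_reaches_move h hM
  · exact exists_represents_reaches_write h hM

theorem eval_dom_iff {l : List Γ} {i : ℕ} :
    (eval (machine M).step ⟨.rewind, i, input l⟩).Dom ↔ (TM0.eval M l).Dom := by
  rw [reaches_eval (reaches_rewind l i)]
  exact tr_eval_dom respects (represents_init l)

end Fold

/-! ### Writing the input -/

namespace TM

section

variable {Q A Q' A' : Type}

/-- Renaming of states and symbols. -/
def congr (M : TM Q A) (eQ : Q ≃ Q') (eA : A ≃ A') : TM Q' A' where
  start := eQ M.start
  blank := eA M.blank
  δ q a := (M.δ (eQ.symm q) (eA.symm a)).map (Prod.map eQ (Prod.map eA id))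

theorem isHom_congr (M : TM Q A) (eQ : Q ≃ Q') (eA : A ≃ A') : M.IsHom (M.congr eQ eA) eQ eA := by
  intro q a
  simp only [congr, Equiv.symm_apply_apply]

end

/-- The tape on which the first `k` letters of `w` have been written. -/
def written {A : Type} (w : ℕ → A) (b : A) (k : ℕ) : ℕ → A := fun j => if j < k then w j else b

theorem update_written {A : Type} (w : ℕ → A) (b : A) (k : ℕ) :
    Function.update (written w b k) k (w k) = written w b (k + 1) := by
  funext j
  rcases lt_trichotomy j k with h | rfl | h
  · rw [Function.update_of_ne h.ne, written, written, if_pos h, if_pos (by omega)]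
  · rw [Function.update_self, written, if_pos (by omega)]
  · rw [Function.update_of_ne h.ne', written, written, if_neg (by omega), if_neg (by omega)]

theorem comp_written {A A' : Type} (g : A → A') (w : ℕ → A) (b : A) (k : ℕ) :
    g ∘ written w b k = written (g ∘ w) (g b) k :=
  funext fun _ => apply_ite g _ _ _

section

variable {n m : ℕ}

/-- The state in which the letter `j` is written, or the initial state of `M` if `k` letters have
been written. -/
def writingState (M : TM (Fin n) (Fin m)) (k j : ℕ) : Fin (n + k) :=
  if h : j < k then Fin.natAdd n ⟨j, h⟩ else Fin.castAdd k M.start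

/-- The machine that writes the first `k` letters of `w` and then behaves like `M`. -/
def writing (M : TM (Fin n) (Fin m)) (w : ℕ → Fin m) (k : ℕ) : TM (Fin (n + k)) (Fin m) where
  start := M.writingState k 0
  blank := M.blank
  δ q a := Fin.addCases (fun q => (M.δ q a).map (Prod.map (Fin.castAdd k) id))
    (fun j => some (M.writingState k (j + 1), w j, .right)) q

variable (M : TM (Fin n) (Fin m)) (w : ℕ → Fin m) (k : ℕ)

theorem isHom_writing : M.IsHom (M.writing w k) (Fin.castAdd k) id := by
  intro q a
  simp only [writing, Fin.addCases_left, id, Prod.map_id]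

theorem reaches_written {j : ℕ} (hj : j ≤ k) :
    StateTransition.Reaches (M.writing w k).step (M.writing w k).init
      ⟨M.writingState k j, j, written w M.blank j⟩ := by
  induction j with
  | zero => exact .refl
  | succ j ih =>
    refine (ih (by omega)).tail (step_eq_some_iff.2 ⟨M.writingState k (j + 1), w j, .right, _, ?_,
      rfl, ?_⟩)
    · have hstate : M.writingState k j = Fin.natAdd n ⟨j, hj⟩ := dif_pos hj
      simp only [writing, hstate, Fin.addCases_right]
    · rw [update_written]

theorem writing_halts_iff : (M.writing w k).Halts ↔
    (StateTransition.eval M.step ⟨M.start, k, written w M.blank k⟩).Dom := by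
  have hstate : M.writingState k k = Fin.castAdd k M.start := dif_neg (lt_irrefl k)
  rw [halts_iff_eval_dom, StateTransition.reaches_eval (M.reaches_written w k le_rfl), hstate,
    ← (M.isHom_writing w k).eval_dom_iff]
  rfl

theorem code_writing : (M.writing w k).code =
    ((n + k, m), (if 0 < k then n + 0 else M.start.val), M.blank.val,
      M.code.2.2.2 ++ (List.range k).map fun j => (List.range m).map fun _ =>
        some (if j + 1 < k then n + (j + 1) else M.start.val, (w j).val, true)) := by
  have hstate (j : ℕ) : (M.writingState k j).val = if j < k then n + j else M.start.val := by
    unfold writingState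
    split_ifs <;> rfl
  refine congrArg₂ Prod.mk rfl (congrArg₂ Prod.mk (hstate 0) (congrArg₂ Prod.mk rfl ?_))
  rw [List.ofFn_add]
  congr 1
  · refine congrArg List.ofFn (funext fun q => congrArg List.ofFn (funext fun a => ?_))
    exact (congrArg (Option.map _) (M.isHom_writing w k q a)).trans (Option.map_map _ _ _)
  · refine ofFn_eq_map_range fun j => ofFn_eq_map_range fun a => ?_
    simp only [writing, Fin.addCases_right, Option.map_some, hstate]

open Primrec in
theorem primrec_code_writing {w : ℕ → Fin m} (hw : Primrec w) :
    Primrec fun k => (M.writing w k).code := by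
  have hstate {α : Type} [Primcodable α] {k j : α → ℕ} (hk : Primrec k) (hj : Primrec j) :
      Primrec fun x => if j x < k x then n + j x else M.start.val :=
    .ite (nat_lt.comp hj hk) (nat_add.comp (.const n) hj) (.const _)
  simp only [code_writing]
  refine ((nat_add.comp (.const n) .id).pair (.const m)).pair ((hstate .id (.const 0)).pair
    ((Primrec.const _).pair (list_append.comp (.const _) (list_map list_range (list_map
      (.const _) (option_some.comp ((hstate ?_ ?_).pair (.pair ?_ (.const true)))))))))
  · exact fst.comp fst
  · exact succ.comp (snd.comp fst)
  · exact fin_val.comp (hw.comp (snd.comp fst))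

end

end TM

theorem Fold.input_append_replicate {Γ : Type} [Inhabited Γ] (l : List Γ) (a : Γ) (k : ℕ) :
    Fold.input (l ++ List.replicate k a) =
      TM.written (fun i => (none :: l.map fun x => some (x, default)).getD i (some (a, default)))
        (some (default, default)) (l.length + 1 + k) := by
  funext i
  rcases i with _ | i
  · rw [TM.written, if_pos (by omega)]
    rfl
  simp only [Fold.input, TM.written, List.getI, List.getD_eq_getElem?_getD,
    List.getElem?_append, List.getElem?_replicate, List.getElem?_cons_succ, List.getElem?_map]
  by_cases hl : i < l.length
  · simp [hl, show i + 1 < l.length + 1 + k by omega]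
  · by_cases hk : i - l.length < k
    · simp [hl, hk, show i + 1 < l.length + 1 + k by omega]
    · simp [hl, hk, show ¬ i + 1 < l.length + 1 + k by omega]

/-! ### Undecidability -/

theorem exists_reduction_to_halts {f : ℕ →. ℕ} (hf : Partrec f) :
    ∃ r : ℕ → TM.Code, Computable r ∧
      ∀ k, ∃ (n m : ℕ) (M : TM (Fin n) (Fin m)), r k = M.code ∧ (M.Halts ↔ (f k).Dom) := by
  obtain ⟨Γ, Λ, _, _, _, _, T, l, a, hT⟩ := exists_machine_of_partrec hf
  let eQ := Finite.equivFin (Fold.State Λ)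
  let eA := Finite.equivFin (Fold.Sym Γ)
  let M := (Fold.machine T).congr eQ eA
  let letters : List (Fold.Sym Γ) := none :: l.map fun x => some (x, default)
  let word i : Fold.Sym Γ := letters.getD i (some (a, default))
  have hword : Primrec (eA ∘ word) :=
    ((Primrec.list_getD (eA (some (a, default)))).comp (.const (letters.map eA)) .id).of_eq
      fun _ => List.getD_map letters (some (a, default)) eA
  refine ⟨fun k => (M.writing (eA ∘ word) (l.length + 1 + k)).code,
    ((M.primrec_code_writing hword).comp (Primrec.nat_add.comp (.const _) .id)).to_comp,
    fun k => ⟨_, _, _, rfl, ?_⟩⟩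
  rw [TM.writing_halts_iff, ← hT k, ← Fold.eval_dom_iff (i := l.length + 1 + k),
    ← ((Fold.machine T).isHom_congr eQ eA).eval_dom_iff, Fold.input_append_replicate,
    TM.Cfg.map, TM.comp_written]
  rfl

theorem not_modelCheckingDecidable : ¬ ModelCheckingDecidable := by
  rintro ⟨decides, hcomputable, hcorrect⟩
  obtain ⟨r, hr, hrf⟩ := exists_reduction_to_halts
    (f := fun k => (Denumerable.ofNat Nat.Partrec.Code k).eval 0)
    (Nat.Partrec.Code.eval_part.comp (Computable.ofNat _) (Computable.const 0))
  have hdecides (c : Nat.Partrec.Code) :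
      decides (reduction (r (Encodable.encode c))) = true ↔ ¬ (c.eval 0).Dom := by
    obtain ⟨n, m, M, hM, hhalts⟩ := hrf (Encodable.encode c)
    obtain ⟨S, P, Act, hS, hP, hAct, G, s, ok, hcode, hsat⟩ := reduction_correct M
    rw [Denumerable.ofNat_encode] at hhalts
    rw [← hhalts, hsat, hM, hcode]
    exact hcorrect _
  refine ComputablePred.halting_problem 0 (ComputablePred.of_eq (ComputablePred.not
    (ComputablePred.computable_iff.2 ⟨_, hcomputable.comp (primrec_reduction.to_comp.comp
      (hr.comp Computable.encode)), rfl⟩)) fun c => ?_)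
  rw [hdecides, not_not]

end ATLiR

theorem mainTheorem1 :
    ¬ ATLiR.ModelCheckingDecidable ∧
    ∃ r : ATLiR.TM.Code → ATLiR.InstanceCode, Computable r ∧
      ∀ (n m : ℕ) (M : ATLiR.TM (Fin n) (Fin m)),
        ∃ (S P Act : ℕ) (hS : 0 < S) (hP : 0 < P) (hAct : 0 < Act)
          (G : ATLiR.CGS (Fin 3) (Fin S) (Fin P) (Fin Act)) (sInit : Fin S) (ok : Fin P),
          r M.code = ATLiR.Instance.code
            { numAgents := 3, numStates := S, numProps := P, numActs := Act
              agents_pos := by decide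
              states_pos := hS, props_pos := hP, acts_pos := hAct
              G := G, state := sInit
              formula := .globally {0, 1} (by simp) (.atom ok) } ∧
          (¬ M.Halts ↔ G.Sat sInit (.globally {0, 1} (by simp) (.atom ok))) :=
  ⟨ATLiR.not_modelCheckingDecidable, ATLiR.reduction, ATLiR.primrec_reduction.to_comp,
    fun _ _ M => ATLiR.reduction_correct M⟩
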